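/- **Setting.** Fix integers $q,m\ge 1$, measurable spaces $\mathcal X,\Theta$ and a measurable function $f:\mathcal X^q\times\Theta^q\to\mathbb R^m$. For each $n$ let $P^n$ be a probability measure on $\mathcal X^n\times\Theta^n$ that has a regular conditional distribution $P^n(d\theta\mid x)$, and let $(x,\theta)\sim P^n$ be independent of a standard Gaussian $z$ in $(\mathbb R^m)^{n^q}$, with law $\mathfrak g$. Write $[n]=\{1,\dots,n\}$. For $g:\mathcal X^q\times\Theta^q\to\mathbb R^m$ let $g^{(n)}(x,\theta)\in(\mathbb R^m)^{n^q}$ have entries $$g^{(n)}_\alpha(x,\theta)=n^{-(q-1)/2}\,g(x_{\alpha_1},\dots,x_{\alpha_q},\theta_{\alpha_1},\dots,\theta_{\alpha_q}),\qquad \alpha\in[n]^q,$$ and, for $t\ge 0$, let $\mu^{n,t}_{g}(\cdot\mid x)$ be the conditional law of $\sqrt t\,g^{(n)}(x,\theta)+z$ given $x$, i.e. the pushforward of $P^n(d\theta\mid x)$ under $\theta\mapsto \sqrt t\,g^{(n)}(x,\theta)$, convolved with $\mathfrak g$. The free energy of $g$ is $$F_n^{g}(t)=\frac1n\,\mathbb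 E\log\int \exp\Big\{t\big(\langle g^{(n)}(x,\theta'),g^{(n)}(x,\theta)\rangle-\tfrac12\|g^{(n)}(x,\theta')\|^2\big)+\sqrt t\,\langle g^{(n)}(x,\theta'),z\rangle\Big\}\,P^n(d\theta'\mid x).$$ Let $\mathcal F$ be the class of functions of the form $$(x_1,\dots,x_q,\theta_1,\dots,\theta_q)\mapsto A_{\psi(x_1)\cdots\psi(x_q)}\big(\phi(\theta_1)\otimes\cdots\otimes\phi(\theta_q)\big)$$ for some $d,k\in\mathbb N$, some bounded measurable $\phi:\Theta\to\mathbb R^d$, some measurable $\psi:\mathcal X\to[k]$ and some matrices $A_\kappa\in\mathbb R^{m\times d^q}$, $\kappa\in[k]^q$. Let $W_2$ be the quadratic Wasserstein distance. **Condition.** For every $\epsilon>0$ and $t\in[0,\infty)$ there is $\hat f\in\mathcal F$ with $$\limsup_{n\to\infty}\frac1n\,\mathbb E\Big[W_2^2\big(\mu^{n,t}_{f}(\cdot\mid x),\,\mu^{n,t}_{\hat f}(\cdot\mid x)\big)\Big]\le\epsilon .$$ **Theorem.** Assume the Condition. Then for every $\epsilon>0$ and $t\in[0,\infty)$ there exists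 $\hat f\in\mathcal F$ such that, for all sufficiently large $n$, the expectations defining $F^{f}_n(t)$ and $F^{\hat f}_n(t)$ are those of integrable random variables, and $$\limsup_{n\to\infty}\big|F^{f}_n(t)-F^{\hat f}_n(t)\big|\le\epsilon .$$ -/

import Mathlib

open MeasureTheory ProbabilityTheory Filter
open scoped ENNReal

noncomputable section

namespace QWise

/-- The observation space `(ℝ^m)^N`, `N = n^q`, with the Euclidean norm and inner product;
the entries are indexed by `α ∈ [n]^q`. -/
abbrev Obs (q m n : ℕ) : Type :=
  PiLp 2 (fun _ : Fin q → Fin n => EuclideanSpace ℝ (Fin m))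

/-- The squared quadratic Wasserstein distance, as an element of `[0, ∞]`: the infimum of
`∫ ‖v - w‖² dγ(v, w)` over all couplings `γ` of `μ` and `ν`. -/
def wassersteinSq {E : Type*} [NormedAddCommGroup E] [MeasurableSpace E]
    (μ ν : Measure E) : ℝ≥0∞ :=
  ⨅ (γ : Measure (E × E)) (_ : γ.map Prod.fst = μ ∧ γ.map Prod.snd = ν),
    ∫⁻ p, ‖p.1 - p.2‖ₑ ^ 2 ∂γ

variable {X Θ : Type*} {q m : ℕ}

/-- The array `f^{(n)}(x, θ)` with entries
`n^{-(q-1)/2} f(x_{α_1}, …, x_{α_q}, θ_{α_1}, …, θ_{α_q})`, for `α ∈ [n]^q`. -/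
def scaledArray (f : (Fin q → X) × (Fin q → Θ) → EuclideanSpace ℝ (Fin m)) (n : ℕ)
    (x : Fin n → X) (θ : Fin n → Θ) : Obs q m n :=
  WithLp.toLp 2 fun α =>
    (1 / Real.sqrt ((n : ℝ) ^ (q - 1))) • f (fun i => x (α i), fun i => θ (α i))

/-- The Hamiltonian
`t (⟨f⁽ⁿ⁾(x,θ'), f⁽ⁿ⁾(x,θ)⟩ - ½ ‖f⁽ⁿ⁾(x,θ')‖²) + √t ⟨f⁽ⁿ⁾(x,θ'), z⟩`. -/
def hamiltonian (f : (Fin q → X) × (Fin q → Θ) → EuclideanSpace ℝ (Fin m)) (n : ℕ) (t : ℝ)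
    (x : Fin n → X) (θ : Fin n → Θ) (z : Obs q m n) (θ' : Fin n → Θ) : ℝ :=
  t * (inner ℝ (scaledArray f n x θ') (scaledArray f n x θ)
      - 1 / 2 * ‖scaledArray f n x θ'‖ ^ 2)
    + Real.sqrt t * inner ℝ (scaledArray f n x θ') z

variable [MeasurableSpace X] [MeasurableSpace Θ]

/-- `log ∫ exp(hamiltonian) P^n(dθ' ∣ x)` as a function of `((x, θ), z)`; here `κ` is the
conditional law of `θ` given `x`. -/
def logPartition (f : (Fin q → X) × (Fin q → Θ) → EuclideanSpace ℝ (Fin m)) (n : ℕ) (t : ℝ)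
    (κ : Kernel (Fin n → X) (Fin n → Θ))
    (p : ((Fin n → X) × (Fin n → Θ)) × Obs q m n) : ℝ :=
  Real.log (∫ θ', Real.exp (hamiltonian f n t p.1.1 p.1.2 p.2 θ') ∂(κ p.1.1))

/-- The joint law of `((x, θ), z)`: `(x, θ) ∼ P` and `z` is an independent standard Gaussian. -/
def jointLaw (q m n : ℕ) (P : Measure ((Fin n → X) × (Fin n → Θ))) :
    Measure (((Fin n → X) × (Fin n → Θ)) × Obs q m n) :=
  P.prod (stdGaussian (Obs q m n))

/-- The free energy `F_n(t)`. -/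
def freeEnergy (f : (Fin q → X) × (Fin q → Θ) → EuclideanSpace ℝ (Fin m)) (n : ℕ) (t : ℝ)
    (P : Measure ((Fin n → X) × (Fin n → Θ))) (κ : Kernel (Fin n → X) (Fin n → Θ)) : ℝ :=
  1 / (n : ℝ) * ∫ p, logPartition f n t κ p ∂(jointLaw q m n P)

/-- The conditional law of the observation `√t f⁽ⁿ⁾(x, θ) + z` given `x`. -/
def condObsLaw (f : (Fin q → X) × (Fin q → Θ) → EuclideanSpace ℝ (Fin m)) (n : ℕ) (t : ℝ)
    (κ : Kernel (Fin n → X) (Fin n → Θ)) (x : Fin n → X) : Measure (Obs q m n) :=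
  ((κ x).map fun θ => Real.sqrt t • scaledArray f n x θ).conv (stdGaussian (Obs q m n))

/-- The class `𝓕` of multilinear functions: those of the form
`A_{ψ(x_1) … ψ(x_q)} (φ(θ_1) ⊗ ⋯ ⊗ φ(θ_q))` with `φ : Θ → ℝ^d` bounded and measurable,
`ψ : X → [k]` measurable, and matrices `A_κ` of size `m × d^q`, for some `d`, `k`. The `j`-th
coordinate of the tensor product, for `j ∈ [d]^q`, is `∏ i, φ(θ_i)_{j_i}`. -/
def IsMultilinear (f : (Fin q → X) × (Fin q → Θ) → EuclideanSpace ℝ (Fin m)) : Prop :=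
  ∃ (d k : ℕ) (φ : Θ → EuclideanSpace ℝ (Fin d)) (ψ : X → Fin k)
    (A : (Fin q → Fin k) → Matrix (Fin m) (Fin q → Fin d) ℝ),
    Measurable φ ∧ (∃ C : ℝ, ∀ θ, ‖φ θ‖ ≤ C) ∧ Measurable ψ ∧
      ∀ (x : Fin q → X) (θ : Fin q → Θ),
        f (x, θ) = WithLp.toLp 2
          ((A fun i => ψ (x i)).mulVec fun j : Fin q → Fin d => ∏ i, φ (θ i) (j i))

/-- The approximation condition: for all `ε > 0` and `t ≥ 0` some `f̂ ∈ 𝓕` satisfies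
`limsup_n (1/n) 𝔼 W₂²(law of √t f⁽ⁿ⁾ + z given x, law of √t f̂⁽ⁿ⁾ + z given x) ≤ ε`. -/
def ApproxCondition (f : (Fin q → X) × (Fin q → Θ) → EuclideanSpace ℝ (Fin m))
    (P : (n : ℕ) → Measure ((Fin n → X) × (Fin n → Θ)))
    (κ : (n : ℕ) → Kernel (Fin n → X) (Fin n → Θ)) : Prop :=
  ∀ ε : ℝ, 0 < ε → ∀ t : ℝ, 0 ≤ t →
    ∃ g : (Fin q → X) × (Fin q → Θ) → EuclideanSpace ℝ (Fin m), IsMultilinear g ∧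
      limsup (fun n : ℕ =>
        (∫⁻ x, wassersteinSq (condObsLaw f n t (κ n) x) (condObsLaw g n t (κ n) x)
          ∂(P n).fst) / (n : ℝ≥0∞)) atTop ≤ ENNReal.ofReal ε

end QWise

end

/-!
Write `w = √t f⁽ⁿ⁾(x, θ)` for the signal and `μ` for its conditional law given `x`. Completing the
square, the partition function is `L(y) = ∫ exp (⟪w', y⟫ - ‖w'‖² / 2) dμ(w')` at the observation
`y = w + z`, and `L` is the density of the law `μ ∗ 𝔤` of the observation with respect to the
standard Gaussian law `𝔤` (Cameron–Martin). The free energy is therefore `1 / n` times the mean over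
`x` of the relative entropy `D(μ)` of `μ ∗ 𝔤` with respect to `𝔤` (`logPartition_eq`,
`integral_log_likelihood_signalLaw`), and everything follows from inequalities for `D` that hold for
each `x` separately. All of them rest on Gibbs' variational inequality
(`integral_le_integral_of_lintegral_exp_le`).

* By Gibbs' inequality and convexity of `log L`, whose gradient is the posterior mean `m`, a
  coupling `(Y, Y')` of `μ ∗ 𝔤` and `ν ∗ 𝔤` gives `D(μ) - D(ν) ≤ 𝔼 ⟪m(Y), Y - Y'⟫`. The
  chain rule for two independent observations bounds `𝔼 ‖m(Y)‖²` by twice the relative entropy of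
  the signal `√2 w` (`integral_norm_posteriorMean_sq_le`). Together these yield, for every `l > 0`,
  `D(μ) - D(ν) ≤ l D(√2 μ) + W₂² / (2 l)` (`ofReal_noisyEntropy_sub_le`).
* Adding independent Gaussian noise to both members of a coupling turns transport cost into relative
  entropy: at half the signal-to-noise ratio, the relative entropy of one signal is at most that of
  another one at the full ratio, plus `W₂² / 2` (`ofReal_noisyEntropy_degrade_sub_le`).

The second point bounds `D(√2 μ)` by `O(n)` uniformly in the approximating function. One fixed
`h ∈ 𝓕` that approximates `f` within distance `1` at ratio `8 t` has entropy `O(n)`, because it is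
bounded. Hence so does `f` at ratio `4 t`, and then so does every `g` close to `f` at ratio `8 t`,
at ratio `2 t`. The second moment of the signal of `f` itself need not be `O(n)`, since the noise
has `n ^ q` entries: this is why the posterior mean takes its place. Choosing `l` small and then `g`
very close to `f` at ratio `8 t` gives the theorem (`abs_meanEntropy_sub_le`); the distance at ratio
`t` is no larger, because the observation at ratio `t` is a degraded version of the one at `8 t`
(`wassersteinSq_degrade_le`).

The Wasserstein distance is not shown to be measurable in `x`. Its lower integral only enters as an
upper bound for integrals of measurable functions (`integral_le_of_lintegral_le`).
-/

namespace QWise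

/-! ### Standard Gaussian vectors and Gibbs' inequality -/

section Gaussian

variable {E : Type*} [NormedAddCommGroup E] [InnerProductSpace ℝ E] [FiniteDimensional ℝ E]
  [MeasurableSpace E] [BorelSpace E]

theorem integral_cexp_stdGaussian (s w : E) :
    ∫ z, Complex.exp ((inner ℝ z s : ℝ) * Complex.I + (inner ℝ z w : ℝ)) ∂(stdGaussian E)
      = Complex.exp ((‖w‖ ^ 2 - ‖s‖ ^ 2) / 2 + (inner ℝ w s : ℝ) * Complex.I) := by
  set b := stdOrthonormalBasis ℝ E
  have h1 (c : ℂ) : ∫ x : ℝ, Complex.exp (c * x) ∂(gaussianReal 0 1)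
      = Complex.exp (c ^ 2 / 2) := by
    have := complexMGF_id_gaussianReal (μ := 0) (v := 1) c
    simpa [complexMGF] using this
  rw [stdGaussian, integral_map (Measurable.aemeasurable (by fun_prop))
    (Measurable.aestronglyMeasurable (by fun_prop))]
  have h2 (x : Fin (Module.finrank ℝ E) → ℝ) :
      Complex.exp ((inner ℝ (∑ i, x i • b i) s : ℝ) * Complex.I
        + (inner ℝ (∑ i, x i • b i) w : ℝ))
      = ∏ i, Complex.exp (((inner ℝ (b i) s : ℝ) * Complex.I + (inner ℝ (b i) w : ℝ)) * x i) := by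
    rw [← Complex.exp_sum]
    congr 1
    simp only [sum_inner, real_inner_smul_left, Complex.ofReal_sum, Complex.ofReal_mul,
      Finset.sum_mul, ← Finset.sum_add_distrib]
    refine Finset.sum_congr rfl fun i _ => ?_
    ring
  simp_rw [b] at h2
  simp_rw [h2]
  rw [integral_fintype_prod_eq_prod (f := fun i (x : ℝ) => Complex.exp
    (((inner ℝ (b i) s : ℝ) * Complex.I + (inner ℝ (b i) w : ℝ)) * x))]
  simp_rw [h1]
  rw [← Complex.exp_sum]
  congr 1
  have hs : ∑ i, (inner ℝ (b i) s) ^ 2 = ‖s‖ ^ 2 := b.sum_sq_inner_right s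
  have hw : ∑ i, (inner ℝ (b i) w) ^ 2 = ‖w‖ ^ 2 := b.sum_sq_inner_right w
  have hws : ∑ i, (inner ℝ (b i) w) * (inner ℝ (b i) s) = inner ℝ w s := by
    rw [← b.sum_inner_mul_inner w s]
    exact Finset.sum_congr rfl fun i _ => by rw [real_inner_comm]
  rw [← hws, ← Complex.ofReal_pow, ← Complex.ofReal_pow, ← hs, ← hw]
  push_cast
  rw [Finset.sum_mul, ← Finset.sum_sub_distrib, Finset.sum_div, ← Finset.sum_add_distrib]
  refine Finset.sum_congr rfl fun i _ => ?_
  linear_combination (inner ℝ (b i) s : ℂ) ^ 2 / 2 * Complex.I_sq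

theorem integrable_exp_inner_stdGaussian (w : E) :
    Integrable (fun z => Real.exp (inner ℝ w z)) (stdGaussian E) := by
  have h := integral_cexp_stdGaussian 0 w
  have h' : Integrable (fun z => Complex.exp
      ((inner ℝ z (0 : E) : ℝ) * Complex.I + (inner ℝ z w : ℝ))) (stdGaussian E) := by
    by_contra hc
    rw [integral_undef hc] at h
    exact Complex.exp_ne_zero _ h.symm
  refine h'.norm.congr (Eventually.of_forall fun z => ?_)
  simp [Complex.norm_exp, real_inner_comm]

theorem integral_exp_inner_stdGaussian (w : E) :
    ∫ z, Real.exp (inner ℝ w z) ∂(stdGaussian E) = Real.exp (‖w‖ ^ 2 / 2) := by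
  have h := integral_cexp_stdGaussian 0 w
  simp only [inner_zero_right, Complex.ofReal_zero, zero_mul, zero_add, norm_zero, ne_eq,
    OfNat.ofNat_ne_zero, not_false_eq_true, zero_pow, sub_zero, add_zero] at h
  apply Complex.ofReal_injective
  rw [← integral_complex_ofReal]
  push_cast
  rw [← h]
  simp_rw [real_inner_comm]

/-- Tilting the standard Gaussian by a linear functional translates it (Cameron–Martin). -/
theorem tilted_stdGaussian (w : E) :
    (stdGaussian E).tilted (fun z => inner ℝ w z) = (stdGaussian E).map (fun z => w + z) := by
  have := isProbabilityMeasure_tilted (integrable_exp_inner_stdGaussian w)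
  have : IsProbabilityMeasure ((stdGaussian E).map (fun z => w + z)) :=
    Measure.isProbabilityMeasure_map (by fun_prop)
  refine Measure.ext_of_charFun (funext fun s => ?_)
  rw [charFun_apply, charFun_apply, integral_map (by fun_prop)
    (Measurable.aestronglyMeasurable (by fun_prop)), integral_tilted,
    integral_exp_inner_stdGaussian]
  have h1 (z : E) : (Real.exp (inner ℝ w z) / Real.exp (‖w‖ ^ 2 / 2)) •
      Complex.exp ((inner ℝ z s : ℝ) * Complex.I) = Complex.exp (-(‖w‖ ^ 2 / 2)) *
      Complex.exp ((inner ℝ z s : ℝ) * Complex.I + (inner ℝ z w : ℝ)) := by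
    rw [← Real.exp_sub, Complex.real_smul, Complex.ofReal_exp, ← Complex.exp_add,
      ← Complex.exp_add, real_inner_comm]
    congr 1
    push_cast
    ring
  have h2 (z : E) : Complex.exp ((inner ℝ (w + z) s : ℝ) * Complex.I) =
      Complex.exp ((inner ℝ w s : ℝ) * Complex.I) *
        Complex.exp ((inner ℝ z s : ℝ) * Complex.I) := by
    rw [← Complex.exp_add, inner_add_left]
    congr 1
    push_cast
    ring
  simp_rw [h1, h2]
  rw [integral_const_mul, integral_const_mul, integral_cexp_stdGaussian, ← charFun_apply,
    charFun_stdGaussian, ← Complex.exp_add, ← Complex.exp_add]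
  congr 1
  ring

/-- Cameron–Martin as a change of variables. -/
theorem lintegral_add_stdGaussian (w : E) {h : E → ℝ≥0∞} (hh : Measurable h) :
    ∫⁻ z, h (w + z) ∂(stdGaussian E)
      = ∫⁻ z, ENNReal.ofReal (Real.exp (inner ℝ w z - ‖w‖ ^ 2 / 2)) * h z ∂(stdGaussian E) := by
  rw [← lintegral_map hh (by fun_prop), ← tilted_stdGaussian, lintegral_tilted,
    integral_exp_inner_stdGaussian]
  simp_rw [← Real.exp_sub]

/-- A rotation of two independent standard Gaussian vectors has a standard Gaussian first
component. -/
theorem map_prod_stdGaussian {a b : ℝ} (hab : a ^ 2 + b ^ 2 = 1) :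
    ((stdGaussian E).prod (stdGaussian E)).map (fun p => a • p.1 + b • p.2) = stdGaussian E := by
  have : IsProbabilityMeasure
      (((stdGaussian E).prod (stdGaussian E)).map (fun p => a • p.1 + b • p.2)) :=
    Measure.isProbabilityMeasure_map (by fun_prop)
  refine Measure.ext_of_charFun (funext fun s => ?_)
  rw [charFun_apply, integral_map (by fun_prop) (Measurable.aestronglyMeasurable (by fun_prop))]
  have h (p : E × E) : Complex.exp ((inner ℝ (a • p.1 + b • p.2) s : ℝ) * Complex.I) =
      Complex.exp ((inner ℝ p.1 (a • s) : ℝ) * Complex.I) *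
      Complex.exp ((inner ℝ p.2 (b • s) : ℝ) * Complex.I) := by
    rw [← Complex.exp_add, inner_add_left, real_inner_smul_left, real_inner_smul_left,
      real_inner_smul_right, real_inner_smul_right]
    congr 1
    push_cast
    ring
  simp_rw [h]
  rw [integral_prod_mul (fun x : E => Complex.exp ((inner ℝ x (a • s) : ℝ) * Complex.I))
    (fun x : E => Complex.exp ((inner ℝ x (b • s) : ℝ) * Complex.I)), ← charFun_apply,
    ← charFun_apply, charFun_stdGaussian, charFun_stdGaussian, charFun_stdGaussian,
    ← Complex.exp_add]
  congr 1
  have hab' : (a : ℂ) ^ 2 + (b : ℂ) ^ 2 = 1 := by exact_mod_cast hab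
  rw [norm_smul, norm_smul]
  push_cast
  rw [mul_pow, mul_pow, ← Complex.ofReal_pow ‖a‖, ← Complex.ofReal_pow ‖b‖, Real.norm_eq_abs,
    Real.norm_eq_abs, sq_abs, sq_abs]
  push_cast
  linear_combination -(‖s‖ : ℂ) ^ 2 / 2 * hab'

theorem lintegral_rotate_stdGaussian {a b : ℝ} (hab : a ^ 2 + b ^ 2 = 1) {h : E → ℝ≥0∞}
    (hh : Measurable h) :
    ∫⁻ z, ∫⁻ z', h (a • z + b • z') ∂(stdGaussian E) ∂(stdGaussian E)
      = ∫⁻ z, h z ∂(stdGaussian E) := by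
  conv_rhs => rw [← map_prod_stdGaussian hab, lintegral_map hh (by fun_prop)]
  rw [lintegral_prod _ (by fun_prop)]

theorem memLp_stdGaussian : MemLp (fun z : E => z) 2 (stdGaussian E) :=
  IsGaussian.memLp_two_id

end Gaussian

theorem integrable_inner_of_memLp {E : Type*} [NormedAddCommGroup E]
    [InnerProductSpace ℝ E] {Ω : Type*} [MeasurableSpace Ω] {ρ : Measure Ω}
    {f g : Ω → E}
    (hf : MemLp f 2 ρ) (hg : MemLp g 2 ρ) :
    Integrable (fun ω => (inner ℝ (f ω) (g ω) : ℝ)) ρ := by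
  have hf2 : Integrable (fun ω => ‖f ω‖ ^ 2) ρ := by
    simpa using hf.integrable_norm_pow (by norm_num)
  have hg2 : Integrable (fun ω => ‖g ω‖ ^ 2) ρ := by
    simpa using hg.integrable_norm_pow (by norm_num)
  refine (hf2.add hg2).mono' (hf.1.inner hg.1) (Eventually.of_forall fun ω => ?_)
  have h1 := norm_inner_le_norm (𝕜 := ℝ) (f ω) (g ω)
  have h2 := two_mul_le_add_sq ‖f ω‖ ‖g ω‖
  have : 0 ≤ ‖f ω‖ * ‖g ω‖ := by positivity
  simp only [Pi.add_apply]
  linarith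

/-- Gibbs' variational inequality in the form needed below: from `𝔼 exp (a - b) ≤ 1` it follows
that `𝔼 a ≤ 𝔼 b`, because `a - b ≤ exp (a - b) - 1`. -/
theorem integral_le_integral_of_lintegral_exp_le {Ω : Type*} [MeasurableSpace Ω] {ρ : Measure Ω}
    [IsProbabilityMeasure ρ] {a b : Ω → ℝ} (ha : Integrable a ρ) (hb : Integrable b ρ)
    (h : ∫⁻ ω, ENNReal.ofReal (Real.exp (a ω - b ω)) ∂ρ ≤ 1) :
    ∫ ω, a ω ∂ρ ≤ ∫ ω, b ω ∂ρ := by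
  have hm : AEStronglyMeasurable (fun ω => Real.exp (a ω - b ω)) ρ :=
    Real.continuous_exp.comp_aestronglyMeasurable (ha.sub hb).aestronglyMeasurable
  have hi : Integrable (fun ω => Real.exp (a ω - b ω)) ρ := by
    refine ⟨hm, ?_⟩
    rw [hasFiniteIntegral_iff_ofReal (Eventually.of_forall fun ω => (Real.exp_pos _).le)]
    exact h.trans_lt ENNReal.one_lt_top
  have h1 : ∫ ω, Real.exp (a ω - b ω) ∂ρ ≤ 1 := by
    rw [integral_eq_lintegral_of_nonneg_ae (Eventually.of_forall fun ω => (Real.exp_pos _).le) hm]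
    exact ENNReal.toReal_le_of_le_ofReal zero_le_one (by simpa using h)
  have h2 : ∫ ω, (a ω - b ω) ∂ρ ≤ ∫ ω, (Real.exp (a ω - b ω) - 1) ∂ρ :=
    integral_mono (ha.sub hb) (hi.sub (integrable_const _)) fun ω => by
      have := Real.add_one_le_exp (a ω - b ω)
      dsimp only
      linarith
  rw [integral_sub ha hb, integral_sub hi (integrable_const _)] at h2
  simp at h2
  linarith

/-! ### The likelihood of a noisy signal -/

section Likelihood

variable {E : Type*} [NormedAddCommGroup E] [InnerProductSpace ℝ E]

/-- The density at `y` of a standard Gaussian vector with mean `w`, with respect to the centred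
standard Gaussian. -/
noncomputable def shiftDensity (w y : E) : ℝ := Real.exp (inner ℝ w y - ‖w‖ ^ 2 / 2)

/-- The density at `y` of `w + z`, where `w ∼ μ` and `z` is an independent standard Gaussian
vector, with respect to the law of `z`. -/
noncomputable def likelihood [MeasurableSpace E] (μ : Measure E) (y : E) : ℝ :=
  ∫ w, shiftDensity w y ∂μ

/-- The relative entropy of the law of `w + z` with respect to the law of `z`, where `w ∼ μ` and
`z` is an independent standard Gaussian vector. -/
noncomputable def noisyEntropy [FiniteDimensional ℝ E] [MeasurableSpace E] (μ : Measure E) : ℝ :=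
  ∫ y, Real.log (likelihood μ y) ∂(μ.conv (stdGaussian E))

/-- The mean of `w ∼ μ` conditionally on `w + z = y`, with `z` an independent standard Gaussian
vector. It is the gradient at `y` of `log (likelihood μ)`. -/
noncomputable def posteriorMean [MeasurableSpace E] (μ : Measure E) (y : E) : E :=
  (likelihood μ y)⁻¹ • ∫ w, shiftDensity w y • w ∂μ

theorem shiftDensity_pos (w y : E) : 0 < shiftDensity w y := Real.exp_pos _

@[fun_prop]
theorem continuous_shiftDensity : Continuous fun p : E × E => shiftDensity p.1 p.2 := by
  unfold shiftDensity
  fun_prop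

theorem continuous_shiftDensity_left (y : E) : Continuous fun w : E => shiftDensity w y := by
  unfold shiftDensity
  fun_prop

theorem inner_sub_sq_le (w y : E) : inner ℝ w y - ‖w‖ ^ 2 / 2 ≤ ‖y‖ ^ 2 / 2 := by
  have h := norm_sub_sq_real w y
  have := sq_nonneg ‖w - y‖
  linarith

theorem le_inner_sub_sq (w y : E) : -(‖y‖ ^ 2 / 2) - ‖w‖ ^ 2 ≤ inner ℝ w y - ‖w‖ ^ 2 / 2 := by
  have h := norm_add_sq_real w y
  have := sq_nonneg ‖w + y‖
  linarith

theorem shiftDensity_le (w y : E) : shiftDensity w y ≤ Real.exp (‖y‖ ^ 2 / 2) :=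
  Real.exp_le_exp.2 (inner_sub_sq_le w y)

variable [MeasurableSpace E] [BorelSpace E] {μ : Measure E}

theorem integrable_shiftDensity [IsProbabilityMeasure μ] (y : E) :
    Integrable (fun w => shiftDensity w y) μ :=
  Integrable.of_bound (continuous_shiftDensity_left y).aestronglyMeasurable
    (Real.exp (‖y‖ ^ 2 / 2)) (Eventually.of_forall fun w => by
      rw [Real.norm_of_nonneg (shiftDensity_pos w y).le]
      exact shiftDensity_le w y)

theorem integrable_shiftDensity_smul {F : Type*} [NormedAddCommGroup F] [NormedSpace ℝ F]
    {h : E → F} (hh : Integrable h μ) (y : E) :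
    Integrable (fun w => shiftDensity w y • h w) μ :=
  hh.bdd_smul (C := Real.exp (‖y‖ ^ 2 / 2)) (continuous_shiftDensity_left y).aestronglyMeasurable
    (Eventually.of_forall fun w => by
      rw [Real.norm_of_nonneg (shiftDensity_pos w y).le]
      exact shiftDensity_le w y)

theorem likelihood_pos [IsProbabilityMeasure μ] (y : E) : 0 < likelihood μ y := by
  have := integral_exp_pos (μ := μ) (f := fun w => inner ℝ w y - ‖w‖ ^ 2 / 2)
    (integrable_shiftDensity y)
  exact this

theorem likelihood_le [IsProbabilityMeasure μ] (y : E) :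
    likelihood μ y ≤ Real.exp (‖y‖ ^ 2 / 2) := by
  have := integral_mono (integrable_shiftDensity (μ := μ) y) (integrable_const _)
    fun w => shiftDensity_le w y
  simpa [likelihood] using this

theorem ofReal_likelihood [IsProbabilityMeasure μ] (y : E) :
    ENNReal.ofReal (likelihood μ y) = ∫⁻ w, ENNReal.ofReal (shiftDensity w y) ∂μ :=
  ofReal_integral_eq_lintegral_ofReal (integrable_shiftDensity y)
    (Eventually.of_forall fun w => (shiftDensity_pos w y).le)

theorem likelihood_map_smul (c : ℝ) (y : E) :
    likelihood (μ.map (fun w => c • w)) y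
      = ∫ w, Real.exp (c * inner ℝ w y - c ^ 2 * ‖w‖ ^ 2 / 2) ∂μ := by
  rw [likelihood, integral_map (by fun_prop)
    (continuous_shiftDensity_left y).aestronglyMeasurable]
  refine integral_congr_ae (Eventually.of_forall fun w => ?_)
  dsimp only
  rw [shiftDensity, real_inner_smul_left, norm_smul, mul_pow, Real.norm_eq_abs, sq_abs]

/-- Two independent observations of `w` at unit signal-to-noise ratio are equivalent to one
observation at twice that ratio. -/
theorem likelihood_map_sqrt_two_smul (y y' : E) :
    likelihood (μ.map (fun w => √2 • w)) ((1 / √2) • (y + y'))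
      = ∫ w, shiftDensity w y * shiftDensity w y' ∂μ := by
  rw [likelihood_map_smul]
  refine integral_congr_ae (Eventually.of_forall fun w => ?_)
  dsimp only
  have h2 : √2 * (1 / √2) = 1 := by field_simp
  rw [shiftDensity, shiftDensity, ← Real.exp_add, real_inner_smul_right, ← mul_assoc, h2,
    Real.sq_sqrt (by norm_num), inner_add_right]
  congr 1
  ring

variable [FiniteDimensional ℝ E]

@[fun_prop]
theorem measurable_shiftDensity : Measurable fun p : E × E => shiftDensity p.1 p.2 :=
  continuous_shiftDensity.measurable

theorem lintegral_shiftDensity (w : E) :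
    ∫⁻ z, ENNReal.ofReal (shiftDensity w z) ∂(stdGaussian E) = 1 := by
  have := lintegral_add_stdGaussian w (h := fun _ => 1) measurable_const
  simp only [lintegral_const, measure_univ, mul_one] at this
  exact this.symm

@[fun_prop]
theorem measurable_likelihood [SFinite μ] : Measurable (likelihood μ) := by
  have : StronglyMeasurable fun p : E × E => shiftDensity p.2 p.1 := by
    exact (Measurable.stronglyMeasurable (by fun_prop))
  exact (this.integral_prod_right (ν := μ)).measurable

@[fun_prop]
theorem measurable_posteriorMean [SFinite μ] : Measurable (posteriorMean μ) := by
  have : StronglyMeasurable fun p : E × E => shiftDensity p.2 p.1 • p.2 := by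
    exact (Measurable.stronglyMeasurable (by fun_prop))
  exact measurable_likelihood.inv.smul (this.integral_prod_right (ν := μ)).measurable

variable [IsProbabilityMeasure μ]

/-- `likelihood μ` is the density of `w + z` with respect to the law of `z`. -/
theorem lintegral_conv_stdGaussian {h : E → ℝ≥0∞} (hh : Measurable h) :
    ∫⁻ y, h y ∂(μ.conv (stdGaussian E))
      = ∫⁻ y, ENNReal.ofReal (likelihood μ y) * h y ∂(stdGaussian E) := by
  rw [Measure.lintegral_conv hh]
  simp_rw [lintegral_add_stdGaussian _ hh, ofReal_likelihood]
  rw [lintegral_lintegral_swap (by fun_prop)]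
  refine lintegral_congr fun y => ?_
  rw [lintegral_mul_const _ (by fun_prop)]
  rfl

theorem lintegral_likelihood :
    ∫⁻ y, ENNReal.ofReal (likelihood μ y) ∂(stdGaussian E) = 1 := by
  have := lintegral_conv_stdGaussian (μ := μ) (h := fun _ => 1) measurable_const
  simpa using this.symm

/-- Jensen's inequality for `exp` gives the lower bound, the pointwise bound on the integrand the
upper one. -/
theorem abs_log_likelihood_le (hμ : MemLp (fun w : E => w) 2 μ) (y : E) :
    |Real.log (likelihood μ y)| ≤ ‖y‖ ^ 2 / 2 + ∫ w, ‖w‖ ^ 2 ∂μ := by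
  have h2 : Integrable (fun w : E => ‖w‖ ^ 2) μ := by
    simpa using hμ.integrable_norm_pow (by norm_num)
  have h0 : 0 ≤ ∫ w, ‖w‖ ^ 2 ∂μ := integral_nonneg fun w => by positivity
  rw [abs_le]
  constructor
  · rw [Real.le_log_iff_exp_le (likelihood_pos y)]
    have hint : Integrable (fun w : E => -(‖y‖ ^ 2 / 2) - ‖w‖ ^ 2) μ :=
      (integrable_const _).sub h2
    have hexp : Integrable (fun w : E => Real.exp (-(‖y‖ ^ 2 / 2) - ‖w‖ ^ 2)) μ :=
      Integrable.of_bound (by fun_prop) 1 (Eventually.of_forall fun w => by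
        rw [Real.norm_of_nonneg (Real.exp_pos _).le, Real.exp_le_one_iff]
        have : 0 ≤ ‖y‖ ^ 2 / 2 := by positivity
        have : 0 ≤ ‖w‖ ^ 2 := by positivity
        linarith)
    have := convexOn_exp.map_integral_le (μ := μ) Real.continuous_exp.continuousOn isClosed_univ
      (f := fun w : E => -(‖y‖ ^ 2 / 2) - ‖w‖ ^ 2) (by simp) hint hexp
    rw [integral_sub (integrable_const _) h2] at this
    simp only [integral_const, probReal_univ, one_smul] at this
    rw [neg_add, ← sub_eq_add_neg]
    refine this.trans (integral_mono hexp (integrable_shiftDensity y) fun w => ?_)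
    exact Real.exp_le_exp.2 (le_inner_sub_sq w y)
  · have := (Real.log_le_iff_le_exp (likelihood_pos (μ := μ) y)).2 (likelihood_le y)
    linarith

theorem integrable_log_likelihood {Ω : Type*} [MeasurableSpace Ω] {ρ : Measure Ω}
    [IsFiniteMeasure ρ] (hμ : MemLp (fun w : E => w) 2 μ) {Y : Ω → E} (hY : MemLp Y 2 ρ) :
    Integrable (fun ω => Real.log (likelihood μ (Y ω))) ρ := by
  have h2 : Integrable (fun ω => ‖Y ω‖ ^ 2) ρ := by
    simpa using hY.integrable_norm_pow (by norm_num)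
  refine Integrable.mono' ((h2.div_const 2).add (integrable_const (∫ w, ‖w‖ ^ 2 ∂μ))) ?_
    (Eventually.of_forall fun ω => abs_log_likelihood_le hμ (Y ω))
  exact (((by fun_prop : Measurable fun y => Real.log (likelihood μ y)).comp_aemeasurable
    hY.aestronglyMeasurable.aemeasurable)).aestronglyMeasurable

theorem memLp_conv_stdGaussian (hμ : MemLp (fun w : E => w) 2 μ) :
    MemLp (fun y : E => y) 2 (μ.conv (stdGaussian E)) := by
  rw [Measure.conv, memLp_map_measure_iff (by fun_prop) (by fun_prop)]
  exact (hμ.comp_fst _).add (memLp_stdGaussian.comp_snd μ)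

/-- The likelihood is log-convex, with the posterior mean as a subgradient of its logarithm. -/
theorem log_likelihood_add_inner_le (hμ : MemLp (fun w : E => w) 2 μ) (y y' : E) :
    Real.log (likelihood μ y) + inner ℝ (posteriorMean μ y) (y' - y)
      ≤ Real.log (likelihood μ y') := by
  have h1 : Integrable (fun w : E => w) μ := hμ.integrable (by norm_num)
  set c := inner ℝ (posteriorMean μ y) (y' - y) with hc
  have hL := likelihood_pos (μ := μ) y
  rw [Real.le_log_iff_exp_le (likelihood_pos y'), Real.exp_add, Real.exp_log hL]
  have hint : Integrable (fun w : E => shiftDensity w y •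
      (Real.exp c * (1 + (inner ℝ w (y' - y) - c)))) μ := by
    refine integrable_shiftDensity_smul (.const_mul ?_ _) y
    exact (integrable_const _).add ((h1.inner_const (y' - y)).sub (integrable_const _))
  have hint2 : Integrable (fun w => shiftDensity w y • w) μ := integrable_shiftDensity_smul h1 y
  have key := integral_mono hint (integrable_shiftDensity y') fun w => by
    have hexp := Real.add_one_le_exp (inner ℝ w (y' - y) - c)
    have : shiftDensity w y' = shiftDensity w y *
        (Real.exp c * Real.exp (inner ℝ w (y' - y) - c)) := by
      rw [shiftDensity, shiftDensity, ← Real.exp_add, ← Real.exp_add, inner_sub_right]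
      congr 1
      ring
    dsimp only
    rw [this, smul_eq_mul]
    have h3 := shiftDensity_pos w y
    gcongr
    linarith
  refine le_trans (le_of_eq ?_) key
  have heq (w : E) : shiftDensity w y • (Real.exp c * (1 + (inner ℝ w (y' - y) - c)))
      = Real.exp c * ((1 - c) * shiftDensity w y + inner ℝ (shiftDensity w y • w) (y' - y)) := by
    rw [real_inner_smul_left, smul_eq_mul]
    ring
  simp_rw [heq]
  rw [integral_const_mul, integral_add ((integrable_shiftDensity y).const_mul _)
    (hint2.inner_const (𝕜 := ℝ) _), integral_const_mul]
  have h4 : ∫ w, inner ℝ (shiftDensity w y • w) (y' - y) ∂μ = likelihood μ y * c := by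
    have := integral_inner (𝕜 := ℝ) hint2 (y' - y)
    simp_rw [real_inner_comm (y' - y)]
    rw [this, real_inner_comm, hc, posteriorMean, real_inner_smul_left]
    field_simp
  rw [h4]
  change _ = Real.exp c * ((1 - c) * likelihood μ y + _)
  ring

/-- Jensen's inequality for the conditional law of `w` given `w + z = y`. -/
theorem likelihood_mul_norm_posteriorMean_sq_le (hμ : MemLp (fun w : E => w) 2 μ) (y : E) :
    likelihood μ y * ‖posteriorMean μ y‖ ^ 2 ≤ ∫ w, shiftDensity w y * ‖w‖ ^ 2 ∂μ := by
  have h1 : Integrable (fun w : E => w) μ := hμ.integrable (by norm_num)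
  have h2 : Integrable (fun w : E => ‖w‖ ^ 2) μ := by
    simpa using hμ.integrable_norm_pow (by norm_num)
  have hL := likelihood_pos (μ := μ) y
  set M := posteriorMean μ y with hM
  have hint2 : Integrable (fun w => shiftDensity w y • w) μ := integrable_shiftDensity_smul h1 y
  have hint3 := integrable_shiftDensity_smul h2 y
  simp only [smul_eq_mul] at hint3
  have heq (w : E) : shiftDensity w y * ‖w - M‖ ^ 2 = shiftDensity w y * ‖w‖ ^ 2
      - 2 * inner ℝ M (shiftDensity w y • w) + shiftDensity w y * ‖M‖ ^ 2 := by
    rw [norm_sub_sq_real, real_inner_smul_right, real_inner_comm]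
    ring
  have h0 : 0 ≤ ∫ w, shiftDensity w y * ‖w - M‖ ^ 2 ∂μ := integral_nonneg fun w =>
    mul_nonneg (shiftDensity_pos w y).le (by positivity)
  simp_rw [heq] at h0
  have hi2 := (hint2.const_inner (𝕜 := ℝ) M).const_mul 2
  have hi3 : Integrable (fun w => shiftDensity w y * ‖w‖ ^ 2
      - 2 * inner ℝ M (shiftDensity w y • w)) μ := hint3.sub hi2
  rw [integral_add hi3 ((integrable_shiftDensity y).mul_const _),
    integral_sub hint3 hi2, integral_const_mul, integral_inner hint2, integral_mul_const] at h0
  have h4 : inner ℝ M (∫ w, shiftDensity w y • w ∂μ) = likelihood μ y * ‖M‖ ^ 2 := by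
    have : ∫ w, shiftDensity w y • w ∂μ = likelihood μ y • M := by
      rw [hM, posteriorMean, smul_smul, mul_inv_cancel₀ hL.ne', one_smul]
    rw [this, real_inner_smul_right, real_inner_self_eq_norm_sq]
  rw [h4] at h0
  change 0 ≤ _ - _ + likelihood μ y * _ at h0
  linarith

theorem memLp_posteriorMean (hμ : MemLp (fun w : E => w) 2 μ) :
    MemLp (posteriorMean μ) 2 (μ.conv (stdGaussian E)) := by
  have h2 : Integrable (fun w : E => ‖w‖ ^ 2) μ := by
    simpa using hμ.integrable_norm_pow (by norm_num)
  rw [memLp_two_iff_integrable_sq_norm measurable_posteriorMean.aestronglyMeasurable]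
  refine ⟨(by fun_prop : Measurable _).aestronglyMeasurable, ?_⟩
  rw [hasFiniteIntegral_iff_ofReal (Eventually.of_forall fun y => by positivity),
    lintegral_conv_stdGaussian (by fun_prop)]
  calc ∫⁻ y, ENNReal.ofReal (likelihood μ y) * ENNReal.ofReal (‖posteriorMean μ y‖ ^ 2)
        ∂(stdGaussian E)
      ≤ ∫⁻ y, ∫⁻ w, ENNReal.ofReal (shiftDensity w y) * ENNReal.ofReal (‖w‖ ^ 2) ∂μ
        ∂(stdGaussian E) := by
        refine lintegral_mono fun y => ?_
        rw [← ENNReal.ofReal_mul (likelihood_pos y).le]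
        refine (ENNReal.ofReal_le_ofReal (likelihood_mul_norm_posteriorMean_sq_le hμ y)).trans ?_
        have hint3 := integrable_shiftDensity_smul h2 y
        simp only [smul_eq_mul] at hint3
        rw [ofReal_integral_eq_lintegral_ofReal hint3 (Eventually.of_forall fun w =>
          mul_nonneg (shiftDensity_pos w y).le (by positivity))]
        refine lintegral_mono fun w => ?_
        dsimp only
        rw [ENNReal.ofReal_mul (shiftDensity_pos w y).le]
    _ = ∫⁻ w, ENNReal.ofReal (‖w‖ ^ 2) ∂μ := by
        rw [lintegral_lintegral_swap (by fun_prop)]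
        refine lintegral_congr fun w => ?_
        rw [lintegral_mul_const _ (by fun_prop)]
        rw [lintegral_shiftDensity, one_mul]
    _ < ∞ := by
        have := h2.2
        rwa [hasFiniteIntegral_iff_ofReal (Eventually.of_forall fun y => by positivity)] at this

end Likelihood

/-! ### Relative entropy of noisy laws -/

section Entropy

variable {E : Type*} [NormedAddCommGroup E] [InnerProductSpace ℝ E] [FiniteDimensional ℝ E]
  [MeasurableSpace E] [BorelSpace E] {μ ν : Measure E}

theorem map_prod_add_stdGaussian [SFinite μ] :
    (μ.prod (stdGaussian E)).map (fun p => (p.1, p.1 + p.2))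
      = (μ.prod (stdGaussian E)).withDensity
        (fun p => ENNReal.ofReal (shiftDensity p.1 p.2)) := by
  refine Measure.ext_of_lintegral _ fun F hF => ?_
  rw [lintegral_map hF (by fun_prop), lintegral_withDensity_eq_lintegral_mul _ (by fun_prop) hF,
    lintegral_prod _ (by fun_prop), lintegral_prod _ (by fun_prop)]
  refine lintegral_congr fun w => ?_
  exact lintegral_add_stdGaussian w (h := fun z => F (w, z)) (by fun_prop)

theorem memLp_map_smul (hμ : MemLp (fun w : E => w) 2 μ) (c : ℝ) :
    MemLp (fun w : E => w) 2 (μ.map (fun w => c • w)) := by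
  rw [memLp_map_measure_iff (by fun_prop) (by fun_prop)]
  exact hμ.const_smul c

instance isProbabilityMeasure_map_smul [IsProbabilityMeasure μ] (c : ℝ) :
    IsProbabilityMeasure (μ.map (fun w => c • w)) :=
  Measure.isProbabilityMeasure_map (by fun_prop)

/-- Degrading the noisy observation `w + z` by the factor `a` and adding fresh noise gives a noisy
observation of `a w`. -/
theorem measurePreserving_degrade [SFinite μ] {a b : ℝ} (hab : a ^ 2 + b ^ 2 = 1) :
    MeasurePreserving (fun p : E × E => a • p.1 + b • p.2)
      ((μ.conv (stdGaussian E)).prod (stdGaussian E))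
      ((μ.map (fun w => a • w)).conv (stdGaussian E)) := by
  refine ⟨by fun_prop, Measure.ext_of_lintegral _ fun F hF => ?_⟩
  rw [lintegral_map hF (by fun_prop), lintegral_prod _ (by fun_prop),
    Measure.lintegral_conv (by fun_prop), Measure.lintegral_conv hF,
    lintegral_map (by fun_prop) (by fun_prop)]
  refine lintegral_congr fun w => ?_
  rw [← lintegral_rotate_stdGaussian hab (h := fun z => F (a • w + z)) (by fun_prop)]
  simp_rw [smul_add, add_assoc]

variable [IsProbabilityMeasure μ] [IsProbabilityMeasure ν]

theorem integral_log_likelihood_le_noisyEntropy (hμ : MemLp (fun w : E => w) 2 μ)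
    (hν : MemLp (fun w : E => w) 2 ν) :
    ∫ y, Real.log (likelihood μ y) ∂(ν.conv (stdGaussian E)) ≤ noisyEntropy ν := by
  have hY := memLp_conv_stdGaussian hν
  refine integral_le_integral_of_lintegral_exp_le (integrable_log_likelihood hμ hY)
    (integrable_log_likelihood hν hY) ?_
  rw [lintegral_conv_stdGaussian (by fun_prop), ← lintegral_likelihood (μ := μ)]
  refine lintegral_mono fun y => ?_
  dsimp only
  rw [Real.exp_sub, Real.exp_log (likelihood_pos y), Real.exp_log (likelihood_pos y),
    ← ENNReal.ofReal_mul (likelihood_pos y).le, mul_div_cancel₀ _ (likelihood_pos y).ne']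

theorem noisyEntropy_nonneg (hμ : MemLp (fun w : E => w) 2 μ) : 0 ≤ noisyEntropy μ := by
  have h := integral_log_likelihood_le_noisyEntropy (μ := Measure.dirac (0 : E))
    (MemLp.of_bound measurable_id.aestronglyMeasurable 0 (by simp [ae_dirac_eq])) hμ
  have h1 (y : E) : likelihood (Measure.dirac (0 : E)) y = 1 := by
    simp [likelihood, shiftDensity]
  simpa [h1] using h

/-- The relative entropy is at most the mean relative entropy of the components of the mixture,
that is half the second moment. -/
theorem noisyEntropy_le (hμ : MemLp (fun w : E => w) 2 μ) :
    noisyEntropy μ ≤ (∫ w, ‖w‖ ^ 2 ∂μ) / 2 := by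
  have h1 : MemLp (fun p : E × E => p.1) 2 (μ.prod (stdGaussian E)) := hμ.comp_fst _
  have h2 : MemLp (fun p : E × E => p.2) 2 (μ.prod (stdGaussian E)) :=
    memLp_stdGaussian.comp_snd μ
  have hi : Integrable (fun p : E × E => (inner ℝ p.1 p.2 : ℝ)) (μ.prod (stdGaussian E)) :=
    integrable_inner_of_memLp h1 h2
  have hsq : Integrable (fun p : E × E => ‖p.1‖ ^ 2) (μ.prod (stdGaussian E)) := by
    simpa using h1.integrable_norm_pow (by norm_num)
  have hb : Integrable (fun p : E × E => (inner ℝ p.1 p.2 : ℝ) + ‖p.1‖ ^ 2 / 2)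
      (μ.prod (stdGaussian E)) := hi.add (hsq.div_const 2)
  have hD : noisyEntropy μ = ∫ p, Real.log (likelihood μ (p.1 + p.2))
      ∂(μ.prod (stdGaussian E)) := by
    rw [noisyEntropy, Measure.conv, integral_map (by fun_prop)
      (by fun_prop : Measurable _).aestronglyMeasurable]
  have key := integral_le_integral_of_lintegral_exp_le
    (integrable_log_likelihood hμ (h1.add h2)) hb (by
      simp only [Pi.add_apply]
      rw [lintegral_prod _ (by fun_prop)]
      calc _ = ∫⁻ w, ∫⁻ z, ENNReal.ofReal (likelihood μ z) ∂(stdGaussian E) ∂μ := by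
            refine lintegral_congr fun w => ?_
            have := lintegral_add_stdGaussian w (h := fun y => ENNReal.ofReal (Real.exp
              (Real.log (likelihood μ y) - (inner ℝ w y - ‖w‖ ^ 2 / 2)))) (by fun_prop)
            have e (z : E) : inner ℝ w (w + z) - ‖w‖ ^ 2 / 2 = inner ℝ w z + ‖w‖ ^ 2 / 2 := by
              rw [inner_add_right, real_inner_self_eq_norm_sq]
              ring
            simp only [e] at this
            rw [this]
            refine lintegral_congr fun z => ?_
            rw [← ENNReal.ofReal_mul (Real.exp_pos _).le, ← Real.exp_add, add_sub_cancel,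
              Real.exp_log (likelihood_pos z)]
        _ ≤ 1 := by simp [lintegral_likelihood])
  simp only [Pi.add_apply] at key
  rw [← hD, integral_add hi (hsq.div_const 2), integral_prod _ hi] at key
  have h0 (w : E) : ∫ z, (inner ℝ w z : ℝ) ∂(stdGaussian E) = 0 := by
    rw [integral_inner (memLp_stdGaussian.integrable (by norm_num)), integral_id_stdGaussian,
      inner_zero_right]
  simp only [h0, integral_zero, zero_add] at key
  rw [integral_div, integral_fun_fst (fun w : E => ‖w‖ ^ 2)] at key
  simpa using key

/-- `𝔼 ⟪m(Y), w⟫ = 𝔼 ‖m(Y)‖²` for `Y = w + z` and `m(Y) = 𝔼[w | Y]`. -/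
theorem integral_inner_posteriorMean (hμ : MemLp (fun w : E => w) 2 μ) :
    ∫ p, inner ℝ (posteriorMean μ (p.1 + p.2)) p.1 ∂(μ.prod (stdGaussian E))
      = ∫ y, ‖posteriorMean μ y‖ ^ 2 ∂(μ.conv (stdGaussian E)) := by
  have hm := memLp_posteriorMean hμ
  have hm' : MemLp (fun p : E × E => posteriorMean μ (p.1 + p.2)) 2
      (μ.prod (stdGaussian E)) :=
    hm.comp_measurePreserving ⟨by fun_prop, rfl⟩
  have h1 : MemLp (fun p : E × E => p.1) 2 (μ.prod (stdGaussian E)) := hμ.comp_fst _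
  have hi : Integrable (fun p : E × E => (inner ℝ (posteriorMean μ (p.1 + p.2)) p.1 : ℝ))
      (μ.prod (stdGaussian E)) := integrable_inner_of_memLp hm' h1
  have hw : Integrable (fun w : E => w) μ := hμ.integrable (by norm_num)
  have hT : Measurable fun p : E × E => (p.1, p.1 + p.2) := by fun_prop
  have hmeas : Measurable fun p : E × E => (inner ℝ (posteriorMean μ p.2) p.1 : ℝ) := by fun_prop
  have hmeas2 : Measurable fun p : E × E => ‖posteriorMean μ p.2‖ ^ 2 := by fun_prop
  -- Both sides become integrals over `μ.prod (stdGaussian E)` weighted by `shiftDensity`, and the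
  -- integral in the first variable is the definition of the posterior mean.
  have change (F : E × E → ℝ) (hF : Measurable F) :
      ∫ p, F (p.1, p.1 + p.2) ∂(μ.prod (stdGaussian E))
        = ∫ p, shiftDensity p.1 p.2 * F p ∂(μ.prod (stdGaussian E)) := by
    rw [← integral_map (φ := fun p : E × E => (p.1, p.1 + p.2)) (by fun_prop)
      hF.aestronglyMeasurable, map_prod_add_stdGaussian,
      integral_withDensity_eq_integral_toReal_smul (by fun_prop) (by simp)]
    refine integral_congr_ae (Eventually.of_forall fun p => ?_)
    simp [ENNReal.toReal_ofReal (shiftDensity_pos _ _).le]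
  have changeI (F : E × E → ℝ) (hF : Measurable F)
      (hFi : Integrable (fun p => F (p.1, p.1 + p.2)) (μ.prod (stdGaussian E))) :
      Integrable (fun p => shiftDensity p.1 p.2 * F p) (μ.prod (stdGaussian E)) := by
    have := (integrable_map_measure (f := fun p : E × E => (p.1, p.1 + p.2)) (g := F)
      hF.aestronglyMeasurable (by fun_prop)).2 hFi
    rw [map_prod_add_stdGaussian, integrable_withDensity_iff_integrable_smul' (by fun_prop)
      (by simp)] at this
    refine this.congr (Eventually.of_forall fun p => ?_)
    simp [ENNReal.toReal_ofReal (shiftDensity_pos _ _).le]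
  have hsq : Integrable (fun p : E × E => ‖posteriorMean μ (p.1 + p.2)‖ ^ 2)
      (μ.prod (stdGaussian E)) := by
    simpa using hm'.integrable_norm_pow (by norm_num)
  rw [Measure.conv, integral_map (by fun_prop) (by fun_prop : Measurable _).aestronglyMeasurable,
    change _ hmeas, change _ hmeas2, integral_prod_symm _ (changeI _ hmeas hi),
    integral_prod_symm _ (changeI _ hmeas2 hsq)]
  refine integral_congr_ae (Eventually.of_forall fun y => ?_)
  dsimp only
  have hL := likelihood_pos (μ := μ) y
  have e1 : ∫ w, shiftDensity w y • w ∂μ = likelihood μ y • posteriorMean μ y := by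
    rw [posteriorMean, smul_smul, mul_inv_cancel₀ hL.ne', one_smul]
  simp_rw [← real_inner_smul_right]
  rw [integral_inner (integrable_shiftDensity_smul hw y), e1, integral_mul_const,
    real_inner_smul_right, real_inner_self_eq_norm_sq]
  rfl

end Entropy

/-! ### The posterior mean and doubling the signal-to-noise ratio -/

section Doubling

variable {E : Type*} [NormedAddCommGroup E] [InnerProductSpace ℝ E] [FiniteDimensional ℝ E]
  [MeasurableSpace E] [BorelSpace E] {μ ν : Measure E} [IsProbabilityMeasure μ]
  [IsProbabilityMeasure ν]

/-- The mean square of the posterior mean is at most twice the relative entropy at doubled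
signal-to-noise ratio. In the chain rule for the pair of observations `(w + z₁, w + z₂)`, the second
one contributes the relative entropy of a law with mean `m(w + z₁)`, which is at least
`‖m(w + z₁)‖² / 2`. -/
theorem integral_norm_posteriorMean_sq_le (hμ : MemLp (fun w : E => w) 2 μ) :
    ∫ y, ‖posteriorMean μ y‖ ^ 2 ∂(μ.conv (stdGaussian E))
      ≤ 2 * noisyEntropy (μ.map (fun w => √2 • w)) := by
  set γ := stdGaussian E with hγ
  set ρ := (μ.prod γ).prod γ with hρ
  set τ := μ.map (fun w => √2 • w) with hτ
  have hτ2 : MemLp (fun w : E => w) 2 τ := memLp_map_smul hμ _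
  have hw : MemLp (fun p : (E × E) × E => p.1.1) 2 ρ :=
    (hμ.comp_fst γ).comp_fst γ
  have hz : MemLp (fun p : (E × E) × E => p.1.2) 2 ρ :=
    ((memLp_stdGaussian (E := E)).comp_snd μ).comp_fst γ
  have hz' : MemLp (fun p : (E × E) × E => p.2) 2 ρ :=
    (memLp_stdGaussian (E := E)).comp_snd (μ.prod γ)
  have hpY : MeasurePreserving (fun p : (E × E) × E => p.1.1 + p.1.2) ρ (μ.conv γ) :=
    (⟨by fun_prop, rfl⟩ : MeasurePreserving (fun p : E × E => p.1 + p.2) (μ.prod γ) (μ.conv γ)).comp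
      measurePreserving_fst
  have hm := memLp_posteriorMean hμ
  have hmY : MemLp (fun p : (E × E) × E => posteriorMean μ (p.1.1 + p.1.2)) 2 ρ :=
    hm.comp_measurePreserving hpY
  have hlogL : Integrable (fun p : (E × E) × E => Real.log (likelihood μ (p.1.1 + p.1.2))) ρ :=
    integrable_log_likelihood hμ (hw.add hz)
  have hmw := integrable_inner_of_memLp hmY hw
  have hmz := integrable_inner_of_memLp hmY hz'
  have hmsq : Integrable (fun p : (E × E) × E => ‖posteriorMean μ (p.1.1 + p.1.2)‖ ^ 2) ρ := by
    simpa using hmY.integrable_norm_pow (by norm_num)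
  have h2 : (1 / √2) ^ 2 + (1 / √2) ^ 2 = 1 := by
    rw [div_pow, Real.sq_sqrt (by norm_num)]
    norm_num
  have h3 : √2 = 1 / √2 + 1 / √2 := by
    rw [← add_div, one_add_one_eq_two, eq_div_iff (by positivity), Real.mul_self_sqrt (by norm_num)]
  have h4 (w : E) : √2 • w = (1 / √2) • w + (1 / √2) • w := by
    rw [← add_smul, ← h3]
  -- The sum of the two observations, normalized, is an observation at doubled ratio.
  have hpU : MeasurePreserving
      (fun p : (E × E) × E => (1 / √2) • ((p.1.1 + p.1.2) + (p.1.1 + p.2))) ρ (τ.conv γ) := by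
    refine ⟨by fun_prop, Measure.ext_of_lintegral _ fun F hF => ?_⟩
    rw [lintegral_map hF (by fun_prop), lintegral_prod _ (by fun_prop),
      lintegral_prod _ (by fun_prop), Measure.lintegral_conv hF,
      lintegral_map (by fun_prop) (by fun_prop)]
    refine lintegral_congr fun w => ?_
    rw [← lintegral_rotate_stdGaussian h2 (h := fun z => F (√2 • w + z)) (by fun_prop)]
    refine lintegral_congr fun z => lintegral_congr fun z' => ?_
    dsimp only
    congr 1
    rw [h4]
    simp only [smul_add]
    abel
  have hb : Integrable (fun p : (E × E) × E =>
      Real.log (likelihood τ ((1 / √2) • ((p.1.1 + p.1.2) + (p.1.1 + p.2))))) ρ :=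
    integrable_log_likelihood hτ2 (((hw.add hz).add (hw.add hz')).const_smul (1 / √2))
  have ha : Integrable (fun p : (E × E) × E => Real.log (likelihood μ (p.1.1 + p.1.2))
      + (inner ℝ (posteriorMean μ (p.1.1 + p.1.2)) p.1.1
        + inner ℝ (posteriorMean μ (p.1.1 + p.1.2)) p.2
        - ‖posteriorMean μ (p.1.1 + p.1.2)‖ ^ 2 / 2)) ρ :=
    hlogL.add ((hmw.add hmz).sub (hmsq.div_const 2))
  have key := integral_le_integral_of_lintegral_exp_le ha hb (by
    let H : E → E → ℝ≥0∞ := fun y y' => ENNReal.ofReal (Real.exp (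
      Real.log (likelihood μ y) + (inner ℝ (posteriorMean μ y) y' - ‖posteriorMean μ y‖ ^ 2 / 2)
        - Real.log (likelihood τ ((1 / √2) • (y + y')))))
    have hH : Measurable fun p : E × E => H p.1 p.2 := by
      dsimp only [H]
      fun_prop
    calc _ = ∫⁻ p, H (p.1.1 + p.1.2) (p.1.1 + p.2) ∂ρ := by
          simp only [H, inner_add_right]
      _ = ∫⁻ w, ∫⁻ z, ∫⁻ z', H (w + z) (w + z') ∂γ ∂γ ∂μ := by
          rw [lintegral_prod _ (by fun_prop), lintegral_prod _ (by fun_prop)]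
      _ = ∫⁻ w, ∫⁻ y, ENNReal.ofReal (shiftDensity w y) *
            ∫⁻ y', ENNReal.ofReal (shiftDensity w y') * H y y' ∂γ ∂γ ∂μ := by
          refine lintegral_congr fun w => ?_
          have e (y : E) : ∫⁻ z', H y (w + z') ∂γ
              = ∫⁻ y', ENNReal.ofReal (shiftDensity w y') * H y y' ∂γ :=
            lintegral_add_stdGaussian w (h := H y) (by fun_prop)
          simp_rw [e]
          exact lintegral_add_stdGaussian w (h := fun y =>
            ∫⁻ y', ENNReal.ofReal (shiftDensity w y') * H y y' ∂γ) (by fun_prop)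
      _ = ∫⁻ y, ∫⁻ y', (∫⁻ w, ENNReal.ofReal (shiftDensity w y) *
            ENNReal.ofReal (shiftDensity w y') ∂μ) * H y y' ∂γ ∂γ := by
          rw [lintegral_lintegral_swap (by fun_prop)]
          refine lintegral_congr fun y => ?_
          have e (w : E) : ENNReal.ofReal (shiftDensity w y) *
              ∫⁻ y', ENNReal.ofReal (shiftDensity w y') * H y y' ∂γ = ∫⁻ y',
              ENNReal.ofReal (shiftDensity w y) * ENNReal.ofReal (shiftDensity w y') * H y y'
                ∂γ := by
            rw [← lintegral_const_mul _ (by fun_prop)]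
            simp_rw [mul_assoc]
          simp_rw [e]
          rw [lintegral_lintegral_swap (by fun_prop)]
          refine lintegral_congr fun y' => ?_
          rw [lintegral_mul_const _ (by fun_prop)]
      _ = ∫⁻ y, ENNReal.ofReal (likelihood μ y) *
            ∫⁻ y', ENNReal.ofReal (shiftDensity (posteriorMean μ y) y') ∂γ ∂γ := by
          refine lintegral_congr fun y => ?_
          rw [← lintegral_const_mul _ (by fun_prop)]
          refine lintegral_congr fun y' => ?_
          have hK : ∫⁻ w, ENNReal.ofReal (shiftDensity w y) *
              ENNReal.ofReal (shiftDensity w y') ∂μ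
              = ENNReal.ofReal (likelihood τ ((1 / √2) • (y + y'))) := by
            have hi : Integrable (fun w => shiftDensity w y * shiftDensity w y') μ := by
              have := integrable_shiftDensity_smul (integrable_shiftDensity (μ := μ) y') y
              simpa using this
            rw [likelihood_map_sqrt_two_smul, ofReal_integral_eq_lintegral_ofReal hi
              (Eventually.of_forall fun w =>
                mul_nonneg (shiftDensity_pos w y).le (shiftDensity_pos w y').le)]
            simp_rw [ENNReal.ofReal_mul (shiftDensity_pos _ y).le]
          rw [hK, ← ENNReal.ofReal_mul (likelihood_pos _).le,
            ← ENNReal.ofReal_mul (likelihood_pos _).le, Real.exp_sub, Real.exp_add,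
            Real.exp_log (likelihood_pos _), Real.exp_log (likelihood_pos _),
            mul_div_cancel₀ _ (likelihood_pos _).ne']
          rfl
      _ = ∫⁻ y, ENNReal.ofReal (likelihood μ y) ∂γ := by
          refine lintegral_congr fun y => ?_
          rw [lintegral_shiftDensity, mul_one]
      _ ≤ 1 := lintegral_likelihood.le)
  have i1 : ∫ p, Real.log (likelihood μ (p.1.1 + p.1.2)) ∂ρ = noisyEntropy μ := by
    rw [noisyEntropy, ← hpY.map_eq, integral_map hpY.aemeasurable
      (by fun_prop : Measurable _).aestronglyMeasurable]
  have i2 : ∫ p, (inner ℝ (posteriorMean μ (p.1.1 + p.1.2)) p.1.1 : ℝ) ∂ρ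
      = ∫ y, ‖posteriorMean μ y‖ ^ 2 ∂(μ.conv γ) := by
    rw [← integral_inner_posteriorMean hμ, integral_fun_fst
      (fun p : E × E => (inner ℝ (posteriorMean μ (p.1 + p.2)) p.1 : ℝ))]
    simp [γ]
  have i3 : ∫ p, (inner ℝ (posteriorMean μ (p.1.1 + p.1.2)) p.2 : ℝ) ∂ρ = 0 := by
    rw [integral_prod _ hmz]
    have h0 (v : E) : ∫ z, (inner ℝ v z : ℝ) ∂γ = 0 := by
      rw [integral_inner (memLp_stdGaussian.integrable (by norm_num)), integral_id_stdGaussian,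
        inner_zero_right]
    simp [h0]
  have i4 : ∫ p, ‖posteriorMean μ (p.1.1 + p.1.2)‖ ^ 2 ∂ρ
      = ∫ y, ‖posteriorMean μ y‖ ^ 2 ∂(μ.conv γ) := by
    rw [← hpY.map_eq, integral_map hpY.aemeasurable
      (by fun_prop : Measurable _).aestronglyMeasurable]
  have i5 : ∫ p, Real.log (likelihood τ ((1 / √2) • ((p.1.1 + p.1.2) + (p.1.1 + p.2)))) ∂ρ
      = noisyEntropy τ := by
    rw [noisyEntropy, ← hpU.map_eq, integral_map hpU.aemeasurable
      (by fun_prop : Measurable _).aestronglyMeasurable]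
  have hs1 : Integrable (fun p : (E × E) × E => (inner ℝ (posteriorMean μ (p.1.1 + p.1.2)) p.1.1
      + inner ℝ (posteriorMean μ (p.1.1 + p.1.2)) p.2 : ℝ)) ρ := hmw.add hmz
  have hs2 : Integrable (fun p : (E × E) × E => (inner ℝ (posteriorMean μ (p.1.1 + p.1.2)) p.1.1
      + inner ℝ (posteriorMean μ (p.1.1 + p.1.2)) p.2
      - ‖posteriorMean μ (p.1.1 + p.1.2)‖ ^ 2 / 2 : ℝ)) ρ := hs1.sub (hmsq.div_const 2)
  rw [integral_add hlogL hs2, integral_sub hs1 (hmsq.div_const 2), integral_add hmw hmz,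
    integral_div, i1, i2, i3, i4, i5] at key
  have h0 := noisyEntropy_nonneg hμ
  linarith

end Doubling

/-! ### Relative entropy and the Wasserstein distance -/

section Transport

variable {E : Type*} [NormedAddCommGroup E] [InnerProductSpace ℝ E] [FiniteDimensional ℝ E]
  [MeasurableSpace E] [BorelSpace E]

theorem enorm_add_sq_le {E : Type*} [NormedAddCommGroup E] [InnerProductSpace ℝ E]
    (x y : E) :
    ‖x + y‖ₑ ^ 2 ≤ 2 * ‖x‖ₑ ^ 2 + 2 * ‖y‖ₑ ^ 2 := by
  have h2 : ENNReal.ofReal 2 = 2 := by simp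
  rw [← ofReal_norm, ← ofReal_norm, ← ofReal_norm, ← ENNReal.ofReal_pow (norm_nonneg _),
    ← ENNReal.ofReal_pow (norm_nonneg _), ← ENNReal.ofReal_pow (norm_nonneg _), ← h2,
    ← ENNReal.ofReal_mul zero_le_two, ← ENNReal.ofReal_mul zero_le_two,
    ← ENNReal.ofReal_add (by positivity) (by positivity)]
  refine ENNReal.ofReal_le_ofReal ?_
  have h3 := parallelogram_law_with_norm ℝ x y
  nlinarith [mul_self_nonneg ‖x - y‖]

theorem wassersteinSq_comm (μ ν : Measure E) : wassersteinSq μ ν = wassersteinSq ν μ := by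
  have h (μ ν : Measure E) : wassersteinSq μ ν ≤ wassersteinSq ν μ := by
    refine le_iInf₂ fun γ hγ => ?_
    have hc : (γ.map Prod.swap).map Prod.fst = μ ∧ (γ.map Prod.swap).map Prod.snd = ν := by
      rw [Measure.map_map measurable_fst measurable_swap,
        Measure.map_map measurable_snd measurable_swap]
      exact ⟨hγ.2, hγ.1⟩
    refine (iInf₂_le (γ.map Prod.swap) hc).trans (le_of_eq ?_)
    rw [lintegral_map (by fun_prop) measurable_swap]
    simp only [Prod.fst_swap, Prod.snd_swap]
    refine lintegral_congr fun p => ?_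
    rw [← enorm_neg, neg_sub]
  exact le_antisymm (h μ ν) (h ν μ)

theorem wassersteinSq_self (μ : Measure E) : wassersteinSq μ μ = 0 := by
  have hc : (μ.map fun w => (w, w)).map Prod.fst = μ ∧
      (μ.map fun w => (w, w)).map Prod.snd = μ := by
    rw [Measure.map_map measurable_fst (by fun_prop), Measure.map_map measurable_snd (by fun_prop)]
    exact ⟨Measure.map_id, Measure.map_id⟩
  refine le_antisymm ((iInf₂_le (μ.map fun w => (w, w)) hc).trans (le_of_eq ?_)) zero_le
  rw [lintegral_map (by fun_prop) (by fun_prop)]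
  simp

/-- To bound a real number by the squared Wasserstein distance of laws with finite second moment, it
suffices to bound it by the Bochner integral of the cost under every coupling. -/
theorem ofReal_le_wassersteinSq {E : Type*} [NormedAddCommGroup E] [MeasurableSpace E]
    {μ ν : Measure E} [IsProbabilityMeasure μ]
    (hμ : MemLp (fun w : E => w) 2 μ)
    (hν : MemLp (fun w : E => w) 2 ν) {c : ℝ}
    (h : ∀ γ : Measure (E × E), IsProbabilityMeasure γ → MeasurePreserving Prod.fst γ μ →
      MeasurePreserving Prod.snd γ ν → c ≤ ∫ p, ‖p.1 - p.2‖ ^ 2 ∂γ) :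
    ENNReal.ofReal c ≤ wassersteinSq μ ν := by
  refine le_iInf₂ fun γ hγ => ?_
  have h1 : MeasurePreserving Prod.fst γ μ := ⟨measurable_fst, hγ.1⟩
  have h2 : MeasurePreserving Prod.snd γ ν := ⟨measurable_snd, hγ.2⟩
  have hp : IsProbabilityMeasure γ := ⟨by
    have := h1.measure_preimage MeasurableSet.univ.nullMeasurableSet
    simpa using this⟩
  have hd : MemLp (fun p : E × E => p.1 - p.2) 2 γ :=
    (hμ.comp_measurePreserving h1).sub (hν.comp_measurePreserving h2)
  have hi : Integrable (fun p : E × E => ‖p.1 - p.2‖ ^ 2) γ := by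
    simpa using hd.integrable_norm_pow (by norm_num)
  refine (ENNReal.ofReal_le_ofReal (h γ hp h1 h2)).trans (le_of_eq ?_)
  rw [ofReal_integral_eq_lintegral_ofReal hi (Eventually.of_forall fun p => by positivity)]
  refine lintegral_congr fun p => ?_
  rw [ENNReal.ofReal_pow (norm_nonneg _), ofReal_norm]

variable {μ ν : Measure E} [IsProbabilityMeasure μ] [IsProbabilityMeasure ν]

/-- Relative entropies of noisy laws differ by at most the Wasserstein distance, up to a multiple of
the entropy at doubled signal-to-noise ratio. By Gibbs' inequality the difference is at most
`𝔼 [log L(Y) - log L(Y')]` for `L = likelihood μ` and a coupling `(Y, Y')`, and by convexity this is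
at most `𝔼 ⟪m(Y), Y - Y'⟫`. -/
theorem ofReal_noisyEntropy_sub_le (hμ : MemLp (fun w : E => w) 2 μ)
    (hν : MemLp (fun w : E => w) 2 ν) {l : ℝ} (hl : 0 < l) :
    ENNReal.ofReal (2 * l * (noisyEntropy μ - noisyEntropy ν
        - l * noisyEntropy (μ.map (fun w => √2 • w))))
      ≤ wassersteinSq (μ.conv (stdGaussian E)) (ν.conv (stdGaussian E)) := by
  have hY := memLp_conv_stdGaussian hμ
  have hY' := memLp_conv_stdGaussian hν
  refine ofReal_le_wassersteinSq hY hY' fun γ hγ h1 h2 => ?_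
  have m1 := hY.comp_measurePreserving h1
  have m2 := hY'.comp_measurePreserving h2
  have mm := (memLp_posteriorMean hμ).comp_measurePreserving h1
  have hsq : Integrable (fun p : E × E => ‖p.1 - p.2‖ ^ 2) γ := by
    simpa using (m1.sub m2).integrable_norm_pow (by norm_num)
  have hmsq : Integrable (fun p : E × E => ‖posteriorMean μ p.1‖ ^ 2) γ := by
    simpa using mm.integrable_norm_pow (by norm_num)
  have i1 : Integrable (fun p : E × E => Real.log (likelihood μ p.1)) γ :=
    integrable_log_likelihood hμ m1
  have i2 : Integrable (fun p : E × E => Real.log (likelihood μ p.2)) γ :=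
    integrable_log_likelihood hμ m2
  have e1 : ∫ p, Real.log (likelihood μ p.1) ∂γ = noisyEntropy μ := by
    rw [noisyEntropy, ← h1.map_eq, integral_map h1.aemeasurable
      (by fun_prop : Measurable _).aestronglyMeasurable]
  have e2 : ∫ p, Real.log (likelihood μ p.2) ∂γ ≤ noisyEntropy ν := by
    have := integral_log_likelihood_le_noisyEntropy hμ hν
    rwa [← h2.map_eq, integral_map h2.aemeasurable
      (by fun_prop : Measurable _).aestronglyMeasurable] at this
  have e3 : ∫ p, ‖posteriorMean μ p.1‖ ^ 2 ∂γ
      = ∫ y, ‖posteriorMean μ y‖ ^ 2 ∂(μ.conv (stdGaussian E)) := by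
    rw [← h1.map_eq, integral_map h1.aemeasurable
      (by fun_prop : Measurable _).aestronglyMeasurable]
  have key := integral_mono ((i1.sub i2).const_mul (2 * l))
    ((hmsq.const_mul (l ^ 2)).add hsq) fun p => by
      have hc := log_likelihood_add_inner_le hμ p.1 p.2
      have hn := norm_sub_sq_real (l • posteriorMean μ p.1) (p.1 - p.2)
      have h0 := sq_nonneg ‖l • posteriorMean μ p.1 - (p.1 - p.2)‖
      rw [norm_smul, mul_pow, Real.norm_eq_abs, sq_abs, real_inner_smul_left] at hn
      rw [← neg_sub p.1 p.2, inner_neg_right] at hc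
      simp only [Pi.sub_apply, Pi.add_apply]
      have := mul_le_mul_of_nonneg_left hc (by positivity : (0 : ℝ) ≤ 2 * l)
      linarith
  simp only [Pi.sub_apply, Pi.add_apply] at key
  rw [integral_const_mul, integral_sub i1 i2, integral_add (hmsq.const_mul _) hsq,
    integral_const_mul, e1, e3] at key
  have hA := mul_le_mul_of_nonneg_left (integral_norm_posteriorMean_sq_le hμ) (sq_nonneg l)
  have hB := mul_le_mul_of_nonneg_left e2 (by positivity : (0 : ℝ) ≤ 2 * l)
  linarith

/-- Averaging the likelihood over fresh noise gives the likelihood of the degraded signal. -/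
theorem lintegral_likelihood_degrade {r : ℝ} (hr : r ^ 2 = 1 / 2) (u : E) :
    ∫⁻ z, ENNReal.ofReal (likelihood μ (r • u + r • z)) ∂(stdGaussian E)
      = ENNReal.ofReal (likelihood (μ.map (fun w => r • w)) u) := by
  simp_rw [ofReal_likelihood]
  rw [lintegral_lintegral_swap (by fun_prop), lintegral_map (by fun_prop) (by fun_prop)]
  refine lintegral_congr fun w => ?_
  have e (z : E) : ENNReal.ofReal (shiftDensity w (r • u + r • z))
      = ENNReal.ofReal (shiftDensity (r • w) u) * ENNReal.ofReal (shiftDensity (r • w) z) := by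
    rw [← ENNReal.ofReal_mul (shiftDensity_pos _ _).le, shiftDensity, shiftDensity, shiftDensity,
      ← Real.exp_add]
    congr 2
    rw [inner_add_right, real_inner_smul_right, real_inner_smul_right, real_inner_smul_left,
      real_inner_smul_left, norm_smul, mul_pow, Real.norm_eq_abs, sq_abs, hr]
    ring
  simp_rw [e]
  rw [lintegral_const_mul _ (by fun_prop), lintegral_shiftDensity, mul_one]

/-- The Gaussian vectors `v + z` and `u + z` have relative entropy `‖u - v‖² / 2`; this is Gibbs'
inequality for that pair. -/
theorem integral_log_likelihood_degrade_le (hμ : MemLp (fun w : E => w) 2 μ) {r : ℝ}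
    (hr : r ^ 2 = 1 / 2) (u v : E) :
    ∫ z, Real.log (likelihood μ (r • v + r • z)) ∂(stdGaussian E)
      ≤ Real.log (likelihood (μ.map (fun w => r • w)) u) + ‖u - v‖ ^ 2 / 2 := by
  have hz : MemLp (fun z : E => z) 2 (stdGaussian E) := memLp_stdGaussian
  have i1 : Integrable (fun z : E => Real.log (likelihood μ (r • v + r • z)))
      (stdGaussian E) :=
    integrable_log_likelihood hμ ((memLp_const (r • v)).add (hz.const_smul r))
  have i2 : Integrable (fun z : E => (inner ℝ (u - v) z : ℝ)) (stdGaussian E) :=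
    (hz.integrable (by norm_num)).const_inner (u - v)
  have i3 : Integrable (fun z : E => (inner ℝ (u - v) z - ‖u - v‖ ^ 2 / 2 : ℝ))
      (stdGaussian E) := i2.sub (integrable_const _)
  have i4 : Integrable (fun z : E => Real.log (likelihood μ (r • v + r • z)) +
      (inner ℝ (u - v) z - ‖u - v‖ ^ 2 / 2 : ℝ)) (stdGaussian E) := i1.add i3
  set K := likelihood (μ.map (fun w => r • w)) u with hK
  have hL : 0 < K := likelihood_pos u
  have h2 := lintegral_add_stdGaussian (u - v)
    (h := fun z => ENNReal.ofReal (likelihood μ (r • v + r • z))) (by fun_prop)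
  have e (z : E) : r • v + r • (u - v + z) = r • u + r • z := by module
  simp only [e, lintegral_likelihood_degrade hr, ← hK] at h2
  have e2 (z : E) : ENNReal.ofReal (Real.exp (Real.log (likelihood μ
      (r • v + r • z)) + (inner ℝ (u - v) z - ‖u - v‖ ^ 2 / 2) - Real.log K))
      = (ENNReal.ofReal K)⁻¹ *
        (ENNReal.ofReal (Real.exp (inner ℝ (u - v) z - ‖u - v‖ ^ 2 / 2)) *
          ENNReal.ofReal (likelihood μ (r • v + r • z))) := by
    rw [← ENNReal.ofReal_mul (Real.exp_pos _).le, ← ENNReal.ofReal_inv_of_pos hL,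
      ← ENNReal.ofReal_mul (inv_pos.2 hL).le, Real.exp_sub, Real.exp_log hL, Real.exp_add,
      Real.exp_log (likelihood_pos _)]
    congr 1
    rw [div_eq_inv_mul, mul_comm (likelihood μ _)]
  have hle : ∫⁻ z, ENNReal.ofReal (Real.exp (Real.log (likelihood μ
      (r • v + r • z)) + (inner ℝ (u - v) z - ‖u - v‖ ^ 2 / 2) - Real.log K))
      ∂(stdGaussian E) ≤ 1 := by
    simp_rw [e2]
    rw [lintegral_const_mul _ (by fun_prop), ← h2,
      ENNReal.inv_mul_cancel (by simpa using hL) ENNReal.ofReal_ne_top]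
  have key := integral_le_integral_of_lintegral_exp_le i4
    (integrable_const (μ := stdGaussian E) (Real.log K)) hle
  rw [integral_add i1 i3, integral_sub i2 (integrable_const _),
    integral_inner (hz.integrable (by norm_num)), integral_id_stdGaussian, inner_zero_right] at key
  simp only [integral_const, probReal_univ, one_smul] at key
  linarith

/-- Relative entropy at halved signal-to-noise ratio is controlled by the Wasserstein distance to
another noisy law and the relative entropy of the latter. -/
theorem ofReal_noisyEntropy_degrade_sub_le (hμ : MemLp (fun w : E => w) 2 μ)
    (hν : MemLp (fun w : E => w) 2 ν) :
    ENNReal.ofReal (2 * (noisyEntropy (μ.map (fun w => (1 / √2) • w)) - noisyEntropy ν))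
      ≤ wassersteinSq (μ.conv (stdGaussian E)) (ν.conv (stdGaussian E)) := by
  have hY := memLp_conv_stdGaussian hμ
  have hY' := memLp_conv_stdGaussian hν
  refine ofReal_le_wassersteinSq hY hY' fun γ hγ h1 h2 => ?_
  set r : ℝ := 1 / √2 with hr
  set τ := μ.map (fun w => r • w) with hτ
  have hτ2 : MemLp (fun w : E => w) 2 τ := memLp_map_smul hμ r
  have hr1 : r ^ 2 = 1 / 2 := by
    rw [hr, div_pow, Real.sq_sqrt (by norm_num), one_pow]
  have hr2 : r ^ 2 + r ^ 2 = 1 := by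
    rw [hr1]
    norm_num
  have m1 := hY.comp_measurePreserving h1
  have m2 := hY'.comp_measurePreserving h2
  have hsq : Integrable (fun p : E × E => ‖p.1 - p.2‖ ^ 2) γ := by
    simpa using (m1.sub m2).integrable_norm_pow (by norm_num)
  have i2 : Integrable (fun p : E × E => Real.log (likelihood (τ.map fun w => r • w) p.2)) γ :=
    integrable_log_likelihood (memLp_map_smul hτ2 r) m2
  have e2 : ∫ p, Real.log (likelihood (τ.map fun w => r • w) p.2) ∂γ ≤ noisyEntropy ν := by
    have := integral_log_likelihood_le_noisyEntropy (memLp_map_smul hτ2 r) hν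
    rwa [← h2.map_eq, integral_map h2.aemeasurable
      (by fun_prop : Measurable _).aestronglyMeasurable] at this
  have hdeg := measurePreserving_degrade (μ := μ) hr2
  have i0 : Integrable (fun p : E × E => Real.log (likelihood τ (r • p.1 + r • p.2)))
      ((μ.conv (stdGaussian E)).prod (stdGaussian E)) :=
    integrable_log_likelihood hτ2 ((memLp_conv_stdGaussian hτ2).comp_measurePreserving hdeg)
  have e1 : noisyEntropy τ = ∫ p, ∫ z, Real.log (likelihood τ (r • p.1 + r • z))
      ∂(stdGaussian E) ∂γ := by
    rw [noisyEntropy, ← hdeg.map_eq, integral_map hdeg.aemeasurable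
      (by fun_prop : Measurable _).aestronglyMeasurable, integral_prod _ i0,
      ← integral_map (φ := Prod.fst) (f := fun v => ∫ z, Real.log (likelihood τ (r • v + r • z))
        ∂(stdGaussian E)) h1.aemeasurable, h1.map_eq]
    rw [h1.map_eq]
    exact i0.integral_prod_left.aestronglyMeasurable
  have i1 : Integrable (fun p : E × E => ∫ z, Real.log (likelihood τ (r • p.1 + r • z))
      ∂(stdGaussian E)) γ :=
    h1.integrable_comp_of_integrable i0.integral_prod_left
  have key := integral_mono i1 (i2.add (hsq.div_const 2)) fun p => by
    have := integral_log_likelihood_degrade_le hτ2 hr1 p.2 p.1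
    rw [norm_sub_rev] at this
    exact this
  simp only [Pi.add_apply] at key
  rw [← e1, integral_add i2 (hsq.div_const 2), integral_div] at key
  linarith

theorem wassersteinSq_degrade_le {a : ℝ} (h0 : 0 ≤ a) (h1 : a ≤ 1) :
    wassersteinSq ((μ.map (fun w => a • w)).conv (stdGaussian E))
        ((ν.map (fun w => a • w)).conv (stdGaussian E))
      ≤ wassersteinSq (μ.conv (stdGaussian E)) (ν.conv (stdGaussian E)) := by
  set b := √(1 - a ^ 2) with hb
  have hab : a ^ 2 + b ^ 2 = 1 := by
    rw [hb, Real.sq_sqrt (by nlinarith)]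
    ring
  refine le_iInf₂ fun γ hγ => ?_
  have g1 : MeasurePreserving Prod.fst γ (μ.conv (stdGaussian E)) := ⟨measurable_fst, hγ.1⟩
  have g2 : MeasurePreserving Prod.snd γ (ν.conv (stdGaussian E)) := ⟨measurable_snd, hγ.2⟩
  have hp : IsProbabilityMeasure γ := ⟨by
    have := g1.measure_preimage MeasurableSet.univ.nullMeasurableSet
    simpa using this⟩
  have hid := MeasurePreserving.id (stdGaussian E)
  -- Both components of the coupling are degraded with the same fresh noise.
  have k1 := (measurePreserving_degrade (μ := μ) hab).comp (g1.prod hid)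
  have k2 := (measurePreserving_degrade (μ := ν) hab).comp (g2.prod hid)
  set δ := (γ.prod (stdGaussian E)).map
    (fun p => (a • p.1.1 + b • p.2, a • p.1.2 + b • p.2)) with hδ
  have hc : δ.map Prod.fst = (μ.map (fun w => a • w)).conv (stdGaussian E) ∧
      δ.map Prod.snd = (ν.map (fun w => a • w)).conv (stdGaussian E) := by
    rw [hδ, Measure.map_map measurable_fst (by fun_prop),
      Measure.map_map measurable_snd (by fun_prop)]
    exact ⟨k1.map_eq, k2.map_eq⟩
  refine (iInf₂_le δ hc).trans ?_
  rw [hδ, lintegral_map (by fun_prop) (by fun_prop), lintegral_prod _ (by fun_prop)]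
  refine lintegral_mono fun p => ?_
  have e (z : E) : a • p.1 + b • z - (a • p.2 + b • z) = a • (p.1 - p.2) := by module
  simp only [e, lintegral_const, measure_univ, mul_one]
  rw [enorm_smul]
  gcongr
  refine mul_le_of_le_one_left' ?_
  rw [Real.enorm_of_nonneg h0]
  simpa using ENNReal.ofReal_le_ofReal h1

/-- A finite Wasserstein distance to the noisy law of a signal with finite second moment forces a
finite second moment. -/
theorem lintegral_enorm_sq_le_wassersteinSq :
    ∫⁻ w, ‖w‖ₑ ^ 2 ∂μ ≤ 4 * wassersteinSq (μ.conv (stdGaussian E)) (ν.conv (stdGaussian E))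
      + (8 * ∫⁻ w, ‖w‖ₑ ^ 2 ∂ν + 10 * ∫⁻ z, ‖z‖ₑ ^ 2 ∂(stdGaussian E)) := by
  set G := ∫⁻ z, ‖z‖ₑ ^ 2 ∂(stdGaussian E) with hG
  have h1 : ∫⁻ w, ‖w‖ₑ ^ 2 ∂μ ≤ 2 * ∫⁻ y, ‖y‖ₑ ^ 2 ∂(μ.conv (stdGaussian E)) + 2 * G := by
    rw [Measure.lintegral_conv (by fun_prop), ← lintegral_const_mul _ (by fun_prop)]
    calc ∫⁻ w, ‖w‖ₑ ^ 2 ∂μ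
        ≤ ∫⁻ w, (2 * ∫⁻ z, ‖w + z‖ₑ ^ 2 ∂(stdGaussian E) + 2 * G) ∂μ := by
          refine lintegral_mono fun w => ?_
          rw [hG, ← lintegral_const_mul _ (by fun_prop), ← lintegral_const_mul _ (by fun_prop),
            ← lintegral_add_left (by fun_prop)]
          calc ‖w‖ₑ ^ 2 = ∫⁻ _, ‖w‖ₑ ^ 2 ∂(stdGaussian E) := by simp
            _ ≤ _ := lintegral_mono fun z => by
                have := enorm_add_sq_le (w + z) (-z)
                rwa [add_neg_cancel_right, enorm_neg] at this
      _ = _ := by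
          rw [lintegral_add_left (by fun_prop)]
          simp
  have h2 : ∫⁻ y, ‖y‖ₑ ^ 2 ∂(ν.conv (stdGaussian E)) ≤ 2 * ∫⁻ w, ‖w‖ₑ ^ 2 ∂ν + 2 * G := by
    rw [Measure.lintegral_conv (by fun_prop)]
    calc ∫⁻ w, ∫⁻ z, ‖w + z‖ₑ ^ 2 ∂(stdGaussian E) ∂ν
        ≤ ∫⁻ w, (2 * ‖w‖ₑ ^ 2 + 2 * G) ∂ν := by
          refine lintegral_mono fun w => ?_
          calc ∫⁻ z, ‖w + z‖ₑ ^ 2 ∂(stdGaussian E)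
              ≤ ∫⁻ z, (2 * ‖w‖ₑ ^ 2 + 2 * ‖z‖ₑ ^ 2) ∂(stdGaussian E) :=
                lintegral_mono fun z => enorm_add_sq_le w z
            _ = _ := by
                rw [lintegral_add_left (by fun_prop), lintegral_const, measure_univ, mul_one,
                  lintegral_const_mul _ (by fun_prop)]
      _ = _ := by
          rw [lintegral_add_left (by fun_prop), lintegral_const_mul _ (by fun_prop)]
          simp
  have h3 : ∫⁻ y, ‖y‖ₑ ^ 2 ∂(μ.conv (stdGaussian E))
      ≤ 2 * wassersteinSq (μ.conv (stdGaussian E)) (ν.conv (stdGaussian E))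
        + 2 * ∫⁻ y, ‖y‖ₑ ^ 2 ∂(ν.conv (stdGaussian E)) := by
    rw [wassersteinSq, ENNReal.mul_iInf_of_ne (by simp) (by simp), ENNReal.iInf_add]
    refine le_iInf fun γ => ?_
    rw [ENNReal.mul_iInf_of_ne (by simp) (by simp), ENNReal.iInf_add]
    refine le_iInf fun hγ => ?_
    rw [← hγ.1, ← hγ.2, lintegral_map (by fun_prop) measurable_fst,
      lintegral_map (by fun_prop) measurable_snd, ← lintegral_const_mul _ (by fun_prop),
      ← lintegral_const_mul _ (by fun_prop), ← lintegral_add_left (by fun_prop)]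
    refine lintegral_mono fun p => ?_
    have := enorm_add_sq_le (p.1 - p.2) p.2
    rwa [sub_add_cancel] at this
  calc _ ≤ 2 * (2 * wassersteinSq (μ.conv (stdGaussian E)) (ν.conv (stdGaussian E))
        + 2 * (2 * ∫⁻ w, ‖w‖ₑ ^ 2 ∂ν + 2 * G)) + 2 * G := by
        refine h1.trans ?_
        gcongr
        refine h3.trans ?_
        gcongr
    _ = _ := by ring

end Transport

/-! ### Averages over conditional laws -/

section ConditionalLaw

variable {A B E : Type*} [MeasurableSpace A] [MeasurableSpace B] [NormedAddCommGroup E]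
  [InnerProductSpace ℝ E] [FiniteDimensional ℝ E] [MeasurableSpace E] [BorelSpace E]

/-- The conditional law of the signal `W (x, θ)` given `x`. -/
noncomputable def signalLaw {F : Type*} [MeasurableSpace F]
    (κ : Kernel A B) (W : A × B → F) (x : A) : Measure F :=
  (κ x).map fun θ => W (x, θ)

/-- The mean over `x` of the relative entropy of the noisy signal given `x`. -/
noncomputable def meanEntropy (P : Measure (A × B)) (κ : Kernel A B) (W : A × B → E) : ℝ :=
  ∫ x, noisyEntropy (signalLaw κ W x) ∂P.fst

/-- The mean over `x` of the squared Wasserstein distance between the conditional laws given `x` of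
two noisy signals. -/
noncomputable def meanWassersteinSq (P : Measure (A × B)) (κ : Kernel A B) (W V : A × B → E) :
    ℝ≥0∞ :=
  ∫⁻ x, wassersteinSq ((signalLaw κ W x).conv (stdGaussian E))
    ((signalLaw κ V x).conv (stdGaussian E)) ∂P.fst

theorem isProbabilityMeasure_signalLaw {F : Type*} [MeasurableSpace F] {κ : Kernel A B}
    [IsMarkovKernel κ] {W : A × B → F} (hW : Measurable W) (x : A) :
    IsProbabilityMeasure (signalLaw κ W x) :=
  Measure.isProbabilityMeasure_map (by fun_prop)

theorem lintegral_signalLaw {F : Type*} [MeasurableSpace F] {κ : Kernel A B} {W : A × B → F}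
    (hW : Measurable W) (x : A) {h : F → ℝ≥0∞} (hh : Measurable h) :
    ∫⁻ w, h w ∂(signalLaw κ W x) = ∫⁻ θ, h (W (x, θ)) ∂(κ x) :=
  lintegral_map hh (by fun_prop)

theorem meanWassersteinSq_comm (P : Measure (A × B)) (κ : Kernel A B) (W V : A × B → E) :
    meanWassersteinSq P κ W V = meanWassersteinSq P κ V W :=
  lintegral_congr fun _ => wassersteinSq_comm _ _

theorem meanWassersteinSq_self (P : Measure (A × B)) (κ : Kernel A B) (W : A × B → E) :
    meanWassersteinSq P κ W W = 0 := by
  simp [meanWassersteinSq, wassersteinSq_self]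

theorem signalLaw_smul {E : Type*} [NormedAddCommGroup E] [NormedSpace ℝ E] [MeasurableSpace E]
    [BorelSpace E] {κ : Kernel A B} {W : A × B → E} (hW : Measurable W) (c : ℝ) (x : A) :
    signalLaw κ (fun p => c • W p) x = (signalLaw κ W x).map (fun w => c • w) := by
  rw [signalLaw, signalLaw, Measure.map_map (measurable_const_smul c) (by fun_prop)]
  rfl

theorem meanWassersteinSq_smul_le (P : Measure (A × B)) {κ : Kernel A B}
    [IsMarkovKernel κ] {W V : A × B → E} (hW : Measurable W) (hV : Measurable V) {a : ℝ}
    (h0 : 0 ≤ a) (h1 : a ≤ 1) : meanWassersteinSq P κ (fun p => a • W p) (fun p => a • V p)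
      ≤ meanWassersteinSq P κ W V := by
  refine lintegral_mono fun x => ?_
  have := isProbabilityMeasure_signalLaw (κ := κ) hW x
  have := isProbabilityMeasure_signalLaw (κ := κ) hV x
  dsimp only
  rw [signalLaw_smul hW, signalLaw_smul hV]
  exact wassersteinSq_degrade_le h0 h1

variable {P : Measure (A × B)} [IsProbabilityMeasure P] {κ : Kernel A B} [IsMarkovKernel κ]
  {W V : A × B → E}

theorem measurable_likelihood_signalLaw (hW : Measurable W) :
    Measurable fun p : A × E => likelihood (signalLaw κ W p.1) p.2 := by
  have h : StronglyMeasurable (Function.uncurry fun (p : A × E) (θ : B) =>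
      shiftDensity (W (p.1, θ)) p.2) := Measurable.stronglyMeasurable (by
    simp only [Function.uncurry_def]
    fun_prop)
  have h2 := (h.integral_kernel_prod_right (κ := Kernel.prodMkRight E κ)).measurable
  convert! h2 using 2 with p
  rw [likelihood, signalLaw, integral_map (by fun_prop)
    (continuous_shiftDensity_left _).aestronglyMeasurable]
  rfl

variable [P.IsCondKernel κ]

theorem ae_memLp_signalLaw (hW : Measurable W) (hW2 : MemLp W 2 P) :
    ∀ᵐ x ∂P.fst, MemLp (fun w : E => w) 2 (signalLaw κ W x) := by
  have h : Integrable (fun p => ‖W p‖ ^ 2) P := by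
    simpa using hW2.integrable_norm_pow (by norm_num)
  rw [← P.disintegrate κ] at h
  filter_upwards [((Measure.integrable_compProd_iff h.aestronglyMeasurable).1 h).1] with x hx
  have hWx : Measurable fun θ => W (x, θ) := by fun_prop
  rw [signalLaw, memLp_map_measure_iff (by fun_prop) (by fun_prop)]
  exact (memLp_two_iff_integrable_sq_norm hWx.aestronglyMeasurable).2 hx

theorem integrable_integral_norm_sq (hW : Measurable W) (hW2 : MemLp W 2 P) :
    Integrable (fun x => ∫ w, ‖w‖ ^ 2 ∂(signalLaw κ W x)) P.fst := by
  have h : Integrable (fun p => ‖W p‖ ^ 2) P := by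
    simpa using hW2.integrable_norm_pow (by norm_num)
  rw [← P.disintegrate κ] at h
  refine (h.integral_compProd (κ := Kernel.const Unit P.fst) (a := ())).congr
    (Eventually.of_forall fun x => ?_)
  dsimp only
  rw [signalLaw, integral_map (by fun_prop) (by fun_prop)]
  rfl

theorem integral_integral_norm_sq (hW : Measurable W) (hW2 : MemLp W 2 P) :
    ∫ x, ∫ w, ‖w‖ ^ 2 ∂(signalLaw κ W x) ∂P.fst = ∫ p, ‖W p‖ ^ 2 ∂P := by
  have h : Integrable (fun p => ‖W p‖ ^ 2) P := by
    simpa using hW2.integrable_norm_pow (by norm_num)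
  have h2 := Measure.integral_compProd (μ := P.fst) (κ := κ) (f := fun p => ‖W p‖ ^ 2)
    (by rwa [P.disintegrate κ])
  rw [P.disintegrate κ] at h2
  rw [h2]
  refine integral_congr_ae (Eventually.of_forall fun x => ?_)
  dsimp only
  rw [signalLaw, integral_map (by fun_prop) (by fun_prop)]

theorem integrable_log_likelihood_signalLaw (hW : Measurable W) (hW2 : MemLp W 2 P) :
    Integrable (fun p : (A × B) × E =>
      Real.log (likelihood (signalLaw κ W p.1.1) (W p.1 + p.2))) (P.prod (stdGaussian E)) := by
  have h1 : MemLp (fun p : (A × B) × E => W p.1 + p.2) 2 (P.prod (stdGaussian E)) :=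
    (hW2.comp_fst _).add (memLp_stdGaussian.comp_snd P)
  have h2 : Integrable (fun p : (A × B) × E => ‖W p.1 + p.2‖ ^ 2) (P.prod (stdGaussian E)) := by
    simpa using h1.integrable_norm_pow (by norm_num)
  have hfst : MeasurePreserving (fun p : (A × B) × E => p.1.1) (P.prod (stdGaussian E)) P.fst :=
    (⟨measurable_fst, rfl⟩ : MeasurePreserving Prod.fst P P.fst).comp measurePreserving_fst
  have h3 : Integrable (fun p : (A × B) × E => ∫ w, ‖w‖ ^ 2 ∂(signalLaw κ W p.1.1))
      (P.prod (stdGaussian E)) :=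
    hfst.integrable_comp_of_integrable (integrable_integral_norm_sq hW hW2)
  have hmeas := (measurable_likelihood_signalLaw (κ := κ) hW).comp
    (by fun_prop : Measurable fun p : (A × B) × E => (p.1.1, W p.1 + p.2))
  refine ((h2.div_const 2).add h3).mono'
    (Real.measurable_log.comp hmeas).aestronglyMeasurable ?_
  filter_upwards [hfst.quasiMeasurePreserving.ae (ae_memLp_signalLaw (κ := κ) hW hW2)] with p hp
  have := isProbabilityMeasure_signalLaw (κ := κ) hW p.1.1
  exact abs_log_likelihood_le hp _

theorem noisyEntropy_signalLaw (hW : Measurable W) {x : A}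
    (hx : MemLp (fun w : E => w) 2 (signalLaw κ W x)) :
    noisyEntropy (signalLaw κ W x) = ∫ θ, ∫ z,
      Real.log (likelihood (signalLaw κ W x) (W (x, θ) + z)) ∂(stdGaussian E) ∂(κ x) := by
  have := isProbabilityMeasure_signalLaw (κ := κ) hW x
  have h1 : Integrable (fun p : E × E => Real.log (likelihood (signalLaw κ W x) (p.1 + p.2)))
      ((signalLaw κ W x).prod (stdGaussian E)) :=
    integrable_log_likelihood hx ((hx.comp_fst _).add (memLp_stdGaussian.comp_snd _))
  rw [noisyEntropy, Measure.conv, integral_map (by fun_prop)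
    (by fun_prop : Measurable _).aestronglyMeasurable, integral_prod _ h1]
  have hmap := integral_map (μ := κ x) (φ := fun θ => W (x, θ)) (by fun_prop)
    h1.integral_prod_left.aestronglyMeasurable
  exact hmap

theorem integrable_noisyEntropy_signalLaw (hW : Measurable W) (hW2 : MemLp W 2 P) :
    Integrable (fun x => noisyEntropy (signalLaw κ W x)) P.fst := by
  have h := (integrable_log_likelihood_signalLaw (κ := κ) hW hW2).integral_prod_left
  rw [← P.disintegrate κ] at h
  refine (h.integral_compProd (κ := Kernel.const Unit P.fst) (a := ())).congr ?_
  filter_upwards [ae_memLp_signalLaw (κ := κ) hW hW2] with x hx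
  exact (noisyEntropy_signalLaw hW hx).symm

theorem integral_log_likelihood_signalLaw (hW : Measurable W) (hW2 : MemLp W 2 P) :
    ∫ p : (A × B) × E, Real.log (likelihood (signalLaw κ W p.1.1) (W p.1 + p.2))
      ∂(P.prod (stdGaussian E)) = meanEntropy P κ W := by
  have h := integrable_log_likelihood_signalLaw (κ := κ) hW hW2
  have hl := h.integral_prod_left
  have h2 := Measure.integral_compProd (μ := P.fst) (κ := κ) (f := fun p => ∫ z,
    Real.log (likelihood (signalLaw κ W p.1) (W p + z)) ∂(stdGaussian E))
    (by rwa [P.disintegrate κ])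
  rw [P.disintegrate κ] at h2
  rw [integral_prod _ h, h2]
  refine integral_congr_ae ?_
  filter_upwards [ae_memLp_signalLaw (κ := κ) hW hW2] with x hx
  exact (noisyEntropy_signalLaw hW hx).symm

theorem meanEntropy_le (hW : Measurable W) (hW2 : MemLp W 2 P) :
    meanEntropy P κ W ≤ (∫ p, ‖W p‖ ^ 2 ∂P) / 2 := by
  rw [← integral_integral_norm_sq (κ := κ) hW hW2, ← integral_div]
  refine integral_mono_ae (integrable_noisyEntropy_signalLaw hW hW2)
    ((integrable_integral_norm_sq hW hW2).div_const 2) ?_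
  filter_upwards [ae_memLp_signalLaw (κ := κ) hW hW2] with x hx
  have := isProbabilityMeasure_signalLaw (κ := κ) hW x
  exact noisyEntropy_le hx

/-- Integration of a pointwise bound of an integrable function. The bounding function need not be
measurable. -/
theorem integral_le_of_lintegral_le {Ω : Type*} [MeasurableSpace Ω] {ρ : Measure Ω} {u : Ω → ℝ}
    {v : Ω → ℝ≥0∞} (hu : Integrable u ρ) (huv : ∀ᵐ ω ∂ρ, ENNReal.ofReal (u ω) ≤ v ω) {c : ℝ}
    (hc : 0 ≤ c) (hv : ∫⁻ ω, v ω ∂ρ ≤ ENNReal.ofReal c) : ∫ ω, u ω ∂ρ ≤ c := by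
  rw [integral_eq_lintegral_pos_part_sub_lintegral_neg_part hu]
  have h1 := ENNReal.toReal_le_of_le_ofReal hc ((lintegral_mono_ae huv).trans hv)
  have h2 := ENNReal.toReal_nonneg (a := ∫⁻ ω, ENNReal.ofReal (-u ω) ∂ρ)
  linarith

theorem meanEntropy_sub_le (hW : Measurable W) (hW2 : MemLp W 2 P) (hV : Measurable V)
    (hV2 : MemLp V 2 P) {l c : ℝ} (hl : 0 < l) (hc : 0 ≤ c)
    (h : meanWassersteinSq P κ W V ≤ ENNReal.ofReal c) :
    2 * l * (meanEntropy P κ W - meanEntropy P κ V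
      - l * meanEntropy P κ (fun p => √2 • W p)) ≤ c := by
  have i1 := integrable_noisyEntropy_signalLaw (κ := κ) hW hW2
  have i2 := integrable_noisyEntropy_signalLaw (κ := κ) hV hV2
  have i3 := integrable_noisyEntropy_signalLaw (κ := κ) (hW.const_smul √2) (hW2.const_smul √2)
  have i4 : Integrable (fun x => noisyEntropy (signalLaw κ W x) - noisyEntropy (signalLaw κ V x))
      P.fst := i1.sub i2
  have key := integral_le_of_lintegral_le ((i4.sub (i3.const_mul l)).const_mul (2 * l))
    (by
      filter_upwards [ae_memLp_signalLaw (κ := κ) hW hW2, ae_memLp_signalLaw (κ := κ) hV hV2]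
        with x hx hx'
      have := isProbabilityMeasure_signalLaw (κ := κ) hW x
      have := isProbabilityMeasure_signalLaw (κ := κ) hV x
      have := ofReal_noisyEntropy_sub_le hx hx' hl
      rw [← signalLaw_smul hW] at this
      exact this) hc h
  simp only [Pi.sub_apply] at key
  rw [integral_const_mul, integral_sub i4 (i3.const_mul l), integral_const_mul,
    integral_sub i1 i2] at key
  exact key

theorem meanEntropy_degrade_sub_le (hW : Measurable W) (hW2 : MemLp W 2 P) (hV : Measurable V)
    (hV2 : MemLp V 2 P) {c : ℝ} (hc : 0 ≤ c)
    (h : meanWassersteinSq P κ W V ≤ ENNReal.ofReal c) :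
    2 * (meanEntropy P κ (fun p => (1 / √2) • W p) - meanEntropy P κ V) ≤ c := by
  have i1 := integrable_noisyEntropy_signalLaw (κ := κ) (hW.const_smul (1 / √2))
    (hW2.const_smul (1 / √2))
  have i2 := integrable_noisyEntropy_signalLaw (κ := κ) hV hV2
  have key := integral_le_of_lintegral_le ((i1.sub i2).const_mul 2)
    (by
      filter_upwards [ae_memLp_signalLaw (κ := κ) hW hW2, ae_memLp_signalLaw (κ := κ) hV hV2]
        with x hx hx'
      have := isProbabilityMeasure_signalLaw (κ := κ) hW x
      have := isProbabilityMeasure_signalLaw (κ := κ) hV x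
      have := ofReal_noisyEntropy_degrade_sub_le hx hx'
      rw [← signalLaw_smul hW] at this
      exact this) hc h
  simp only [Pi.sub_apply] at key
  rw [integral_const_mul, integral_sub i1 i2] at key
  exact key

theorem memLp_of_meanWassersteinSq_ne_top (hW : Measurable W) (hV : Measurable V)
    (hV2 : MemLp V 2 P) (h : meanWassersteinSq P κ W V ≠ ∞) : MemLp W 2 P := by
  have key (U : A × B → E) (hU : Measurable U) :
      ∫⁻ p, ‖U p‖ₑ ^ 2 ∂P = ∫⁻ x, ∫⁻ w, ‖w‖ₑ ^ 2 ∂(signalLaw κ U x) ∂P.fst := by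
    have := Measure.lintegral_compProd (μ := P.fst) (κ := κ) (f := fun p => ‖U p‖ₑ ^ 2)
      (by fun_prop)
    rw [P.disintegrate κ] at this
    rw [this]
    exact lintegral_congr fun x => (lintegral_signalLaw hU x
      (h := fun w => ‖w‖ₑ ^ 2) (by fun_prop)).symm
  have hiff (U : A × B → E) (hU : Measurable U) : MemLp U 2 P ↔ ∫⁻ p, ‖U p‖ₑ ^ 2 ∂P < ∞ := by
    rw [MemLp, eLpNorm_lt_top_iff_lintegral_rpow_enorm_lt_top (by simp) (by simp)]
    simp [hU.aestronglyMeasurable]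
  have hmeas : Measurable fun x => ∫⁻ w, ‖w‖ₑ ^ 2 ∂(signalLaw κ V x) := by
    have hsq : Measurable fun w : E => ‖w‖ₑ ^ 2 := by fun_prop
    simp_rw [lintegral_signalLaw hV _ hsq]
    exact Measurable.lintegral_kernel_prod_right' (f := fun p : A × B => ‖V p‖ₑ ^ 2)
      (by fun_prop)
  have hG : ∫⁻ z, ‖z‖ₑ ^ 2 ∂(stdGaussian E) < ∞ := by
    have := (memLp_stdGaussian (E := E)).2
    rw [eLpNorm_lt_top_iff_lintegral_rpow_enorm_lt_top (by simp) (by simp)] at this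
    simpa using this
  rw [hiff W hW, key W hW]
  rw [hiff V hV, key V hV] at hV2
  calc _ ≤ ∫⁻ x, (4 * wassersteinSq ((signalLaw κ W x).conv (stdGaussian E))
        ((signalLaw κ V x).conv (stdGaussian E)) + (8 * ∫⁻ w, ‖w‖ₑ ^ 2 ∂(signalLaw κ V x)
          + 10 * ∫⁻ z, ‖z‖ₑ ^ 2 ∂(stdGaussian E))) ∂P.fst := by
        refine lintegral_mono fun x => ?_
        have := isProbabilityMeasure_signalLaw (κ := κ) hW x
        have := isProbabilityMeasure_signalLaw (κ := κ) hV x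
        exact lintegral_enorm_sq_le_wassersteinSq
    _ = 4 * meanWassersteinSq P κ W V + (8 * (∫⁻ x, ∫⁻ w, ‖w‖ₑ ^ 2 ∂(signalLaw κ V x) ∂P.fst)
          + 10 * ∫⁻ z, ‖z‖ₑ ^ 2 ∂(stdGaussian E)) := by
        rw [lintegral_add_right _ (by fun_prop), lintegral_const_mul' _ _ (by simp),
          lintegral_add_right _ (by fun_prop), lintegral_const_mul _ (by fun_prop),
          lintegral_const, measure_univ, mul_one]
        rfl
    _ < ∞ := ENNReal.add_lt_top.2 ⟨ENNReal.mul_lt_top (by simp) h.lt_top,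
        ENNReal.add_lt_top.2 ⟨ENNReal.mul_lt_top (by simp) hV2,
          ENNReal.mul_lt_top (by simp) hG⟩⟩

end ConditionalLaw

/-! ### The observation model -/

section Model

variable {X Θ : Type*} {q m : ℕ}

/-- The signal `√t f⁽ⁿ⁾(x, θ)` in the observation model. -/
noncomputable def signal (f : (Fin q → X) × (Fin q → Θ) → EuclideanSpace ℝ (Fin m)) (n : ℕ)
    (t : ℝ) (p : (Fin n → X) × (Fin n → Θ)) : Obs q m n :=
  √t • scaledArray f n p.1 p.2

theorem signal_mul (f : (Fin q → X) × (Fin q → Θ) → EuclideanSpace ℝ (Fin m)) (n : ℕ) {c : ℝ}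
    (hc : 0 ≤ c) (t : ℝ) : signal f n (c * t) = fun p => √c • signal f n t p := by
  funext p
  rw [signal, signal, Real.sqrt_mul hc, mul_smul]

/-- Each of the `n ^ q` entries of `f⁽ⁿ⁾` has square norm at most `C² / n ^ (q - 1)`. -/
theorem norm_scaledArray_sq_le {f : (Fin q → X) × (Fin q → Θ) → EuclideanSpace ℝ (Fin m)}
    (hq : 0 < q) {C : ℝ} (hC : ∀ p, ‖f p‖ ≤ C) {n : ℕ} (hn : 0 < n) (x : Fin n → X)
    (θ : Fin n → Θ) : ‖scaledArray f n x θ‖ ^ 2 ≤ n * C ^ 2 := by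
  have hn' : (0 : ℝ) < n := by exact_mod_cast hn
  rw [PiLp.norm_sq_eq_of_L2]
  have h (α : Fin q → Fin n) : ‖scaledArray f n x θ α‖ ^ 2 ≤ 1 / (n : ℝ) ^ (q - 1) * C ^ 2 := by
    simp only [scaledArray]
    rw [norm_smul, mul_pow, Real.norm_eq_abs, sq_abs, div_pow, one_pow,
      Real.sq_sqrt (by positivity)]
    have := hC (fun i => x (α i), fun i => θ (α i))
    gcongr
  refine (Finset.sum_le_sum fun α _ => h α).trans (le_of_eq ?_)
  rw [Finset.sum_const, Finset.card_univ, Fintype.card_fun, Fintype.card_fin, Fintype.card_fin,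
    nsmul_eq_mul]
  obtain ⟨k, rfl⟩ : ∃ k, q = k + 1 := ⟨q - 1, by omega⟩
  rw [Nat.add_sub_cancel]
  push_cast
  rw [pow_succ]
  field_simp

variable [MeasurableSpace X] [MeasurableSpace Θ]

theorem measurable_signal {f : (Fin q → X) × (Fin q → Θ) → EuclideanSpace ℝ (Fin m)}
    (hf : Measurable f) (n : ℕ) (t : ℝ) : Measurable (signal f n t) := by
  have h : Measurable fun p : (Fin n → X) × (Fin n → Θ) =>
      (scaledArray f n p.1 p.2 : Obs q m n) := by
    refine (WithLp.measurable_toLp 2 _).comp (measurable_pi_lambda _ fun α => ?_)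
    exact (hf.comp (by fun_prop)).const_smul (1 / √((n : ℝ) ^ (q - 1)))
  exact h.const_smul √t

/-- Completing the square, the partition function is the likelihood ratio of the observation
`√t f⁽ⁿ⁾(x, θ) + z` given `x`. -/
theorem logPartition_eq {f : (Fin q → X) × (Fin q → Θ) → EuclideanSpace ℝ (Fin m)}
    (hf : Measurable f) (n : ℕ) {t : ℝ} (ht : 0 ≤ t) (κ : Kernel (Fin n → X) (Fin n → Θ))
    (p : ((Fin n → X) × (Fin n → Θ)) × Obs q m n) :
    logPartition f n t κ p
      = Real.log (likelihood (signalLaw κ (signal f n t) p.1.1) (signal f n t p.1 + p.2)) := by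
  have hm := measurable_signal hf n t
  rw [logPartition, likelihood, signalLaw, integral_map (by fun_prop)
    (continuous_shiftDensity_left _).aestronglyMeasurable]
  congr 1
  refine integral_congr_ae (Eventually.of_forall fun θ' => ?_)
  dsimp only
  rw [shiftDensity, hamiltonian, signal, signal, inner_add_right, real_inner_smul_left,
    real_inner_smul_left, real_inner_smul_right, norm_smul, mul_pow, Real.norm_eq_abs, sq_abs,
    Real.sq_sqrt ht, ← mul_assoc (√t) (√t), Real.mul_self_sqrt ht]
  congr 1
  ring

theorem IsMultilinear.measurable_and_bounded
    {f : (Fin q → X) × (Fin q → Θ) → EuclideanSpace ℝ (Fin m)} (hf : IsMultilinear f) :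
    Measurable f ∧ ∃ C : ℝ, 0 ≤ C ∧ ∀ p, ‖f p‖ ≤ C := by
  obtain ⟨d, k, φ, ψ, A, hφ, ⟨C, hC⟩, hψ, hfA⟩ := hf
  let T : (Fin q → Fin k) → (Fin q → EuclideanSpace ℝ (Fin d)) → EuclideanSpace ℝ (Fin m) :=
    fun a v => WithLp.toLp 2 ((A a).mulVec fun j : Fin q → Fin d => ∏ i, v i (j i))
  have hT (a : Fin q → Fin k) : Continuous (T a) := by
    refine (PiLp.continuous_toLp 2 _).comp (Continuous.matrix_mulVec continuous_const ?_)
    fun_prop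
  have hf' (p : (Fin q → X) × (Fin q → Θ)) :
      f p = T (fun i => ψ (p.1 i)) (fun i => φ (p.2 i)) := hfA p.1 p.2
  constructor
  · have h1 : Measurable fun p : (Fin q → Fin k) × (Fin q → EuclideanSpace ℝ (Fin d)) =>
        T p.1 p.2 := measurable_from_prod_countable_right fun a => (hT a).measurable
    have h2 : Measurable fun p : (Fin q → X) × (Fin q → Θ) =>
        ((fun i => ψ (p.1 i) : Fin q → Fin k), fun i => φ (p.2 i)) := by fun_prop
    convert! h1.comp h2 using 1
    exact funext hf'
  · -- The values of `f` lie in a finite union of continuous images of a compact set.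
    have hK : IsCompact (⋃ a, T a '' Set.pi Set.univ fun _ => Metric.closedBall 0 C) :=
      isCompact_iUnion fun a =>
        (isCompact_univ_pi fun _ => isCompact_closedBall 0 C).image (hT a)
    obtain ⟨R, hR⟩ := hK.isBounded.exists_norm_le
    refine ⟨max R 0, le_max_right _ _, fun p => (hR _ ?_).trans (le_max_left _ _)⟩
    rw [hf' p]
    exact Set.mem_iUnion.2 ⟨_, _, fun i _ => by simpa using hC _, rfl⟩

theorem memLp_signal {f : (Fin q → X) × (Fin q → Θ) → EuclideanSpace ℝ (Fin m)}
    (hf : Measurable f) (hq : 0 < q) {C : ℝ} (hC : ∀ p, ‖f p‖ ≤ C) {n : ℕ} (hn : 0 < n) {t : ℝ}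
    (ht : 0 ≤ t) (P : Measure ((Fin n → X) × (Fin n → Θ))) [IsProbabilityMeasure P] :
    MemLp (signal f n t) 2 P ∧ ∫ p, ‖signal f n t p‖ ^ 2 ∂P ≤ n * (t * C ^ 2) := by
  have hb (p : (Fin n → X) × (Fin n → Θ)) : ‖signal f n t p‖ ^ 2 ≤ n * (t * C ^ 2) := by
    rw [signal, norm_smul, mul_pow, Real.norm_eq_abs, sq_abs, Real.sq_sqrt ht]
    have := mul_le_mul_of_nonneg_left (norm_scaledArray_sq_le hq hC hn p.1 p.2) ht
    linarith
  have hL : MemLp (signal f n t) 2 P :=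
    MemLp.of_bound (measurable_signal hf n t).aestronglyMeasurable (√(n * (t * C ^ 2)))
      (Eventually.of_forall fun p => Real.le_sqrt_of_sq_le (hb p))
  have hi : Integrable (fun p => ‖signal f n t p‖ ^ 2) P := by
    simpa using hL.integrable_norm_pow (by norm_num)
  refine ⟨hL, (integral_mono hi (integrable_const _) hb).trans ?_⟩
  simp

theorem integrable_logPartition {f : (Fin q → X) × (Fin q → Θ) → EuclideanSpace ℝ (Fin m)}
    (hf : Measurable f) {n : ℕ} {t : ℝ} (ht : 0 ≤ t) {P : Measure ((Fin n → X) × (Fin n → Θ))}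
    [IsProbabilityMeasure P] {κ : Kernel (Fin n → X) (Fin n → Θ)} [IsMarkovKernel κ]
    [P.IsCondKernel κ] (hL : MemLp (signal f n t) 2 P) :
    Integrable (logPartition f n t κ) (jointLaw q m n P) ∧
      freeEnergy f n t P κ = 1 / n * meanEntropy P κ (signal f n t) := by
  have hm := measurable_signal hf n t
  have he : logPartition f n t κ = fun p => Real.log
      (likelihood (signalLaw κ (signal f n t) p.1.1) (signal f n t p.1 + p.2)) :=
    funext fun p => logPartition_eq hf n ht κ p
  rw [freeEnergy, he, jointLaw, integral_log_likelihood_signalLaw hm hL]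
  exact ⟨integrable_log_likelihood_signalLaw hm hL, rfl⟩

/-- The quantitative comparison at fixed `n`. The function `h` serves only to bound the relative
entropies of `f` and `g`, through the larger signal-to-noise ratios `2t`, `4t` and `8t`. -/
theorem abs_meanEntropy_sub_le {f g h : (Fin q → X) × (Fin q → Θ) → EuclideanSpace ℝ (Fin m)}
    (hf : Measurable f) (hg : Measurable g) (hh : Measurable h) {n : ℕ} {t : ℝ}
    {P : Measure ((Fin n → X) × (Fin n → Θ))}
    [IsProbabilityMeasure P] {κ : Kernel (Fin n → X) (Fin n → Θ)} [IsMarkovKernel κ]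
    [P.IsCondKernel κ] (hf2 : MemLp (signal f n (8 * t)) 2 P)
    (hg2 : MemLp (signal g n (8 * t)) 2 P) (hh2 : MemLp (signal h n (8 * t)) 2 P) {l a b K : ℝ}
    (hl : 0 < l) (ha : 0 ≤ a) (hb : 0 ≤ b) (hK : ∫ p, ‖signal h n (8 * t) p‖ ^ 2 ∂P ≤ K)
    (hfg : meanWassersteinSq P κ (signal f n (8 * t)) (signal g n (8 * t)) ≤ ENNReal.ofReal a)
    (hfh : meanWassersteinSq P κ (signal f n (8 * t)) (signal h n (8 * t)) ≤ ENNReal.ofReal b) :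
    |meanEntropy P κ (signal f n t) - meanEntropy P κ (signal g n t)|
      ≤ l * ((K + a + b) / 2) + a / (2 * l) := by
  have e (u : (Fin q → X) × (Fin q → Θ) → EuclideanSpace ℝ (Fin m)) (c : ℝ) (hc : 0 ≤ c) :
      signal u n (c * t) = fun p => √(c / 8) • signal u n (8 * t) p := by
    rw [← signal_mul u n (by positivity)]
    congr 1
    ring
  have mem (u : (Fin q → X) × (Fin q → Θ) → EuclideanSpace ℝ (Fin m))
      (hu : MemLp (signal u n (8 * t)) 2 P) (c : ℝ) (hc : 0 ≤ c) :
      MemLp (signal u n (c * t)) 2 P := by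
    rw [e u c hc]
    exact hu.const_smul √(c / 8)
  have mono (u v : (Fin q → X) × (Fin q → Θ) → EuclideanSpace ℝ (Fin m)) (hu : Measurable u)
      (hv : Measurable v) (c : ℝ) (hc : 0 ≤ c) (hc8 : c ≤ 8) :
      meanWassersteinSq P κ (signal u n (c * t)) (signal v n (c * t))
        ≤ meanWassersteinSq P κ (signal u n (8 * t)) (signal v n (8 * t)) := by
    rw [e u c hc, e v c hc]
    exact meanWassersteinSq_smul_le P (measurable_signal hu n _) (measurable_signal hv n _)
      (Real.sqrt_nonneg _) (Real.sqrt_le_one.2 (by linarith))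
  -- Relative entropy at ratio `c t`, against another signal at ratio `2 c t`.
  have step (u v : (Fin q → X) × (Fin q → Θ) → EuclideanSpace ℝ (Fin m)) (hu : Measurable u)
      (hv : Measurable v) (hu2 : MemLp (signal u n (8 * t)) 2 P)
      (hv2 : MemLp (signal v n (8 * t)) 2 P) (c : ℝ) (hc : 0 ≤ c) (hc4 : c ≤ 4) {r : ℝ}
      (hr : 0 ≤ r) (hw : meanWassersteinSq P κ (signal u n (8 * t)) (signal v n (8 * t))
        ≤ ENNReal.ofReal r) :
      meanEntropy P κ (signal u n (c * t))
        ≤ meanEntropy P κ (signal v n ((2 * c) * t)) + r / 2 := by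
    have h1 := meanEntropy_degrade_sub_le (κ := κ) (measurable_signal hu n ((2 * c) * t))
      (mem u hu2 (2 * c) (by positivity)) (measurable_signal hv n ((2 * c) * t))
      (mem v hv2 (2 * c) (by positivity)) hr
      ((mono u v hu hv (2 * c) (by positivity) (by linarith)).trans hw)
    have h2 : (fun p => (1 / √2) • signal u n ((2 * c) * t) p) = signal u n (c * t) := by
      have h3 := signal_mul u n (by norm_num : (0 : ℝ) ≤ 1 / 2) ((2 * c) * t)
      rw [Real.sqrt_div zero_le_one, Real.sqrt_one] at h3
      rw [← h3]
      congr 1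
      ring
    rw [h2] at h1
    linarith
  have compare (u v : (Fin q → X) × (Fin q → Θ) → EuclideanSpace ℝ (Fin m)) (hu : Measurable u)
      (hv : Measurable v) (hu2 : MemLp (signal u n (8 * t)) 2 P)
      (hv2 : MemLp (signal v n (8 * t)) 2 P)
      (hw : meanWassersteinSq P κ (signal u n (8 * t)) (signal v n (8 * t))
        ≤ ENNReal.ofReal a) :
      meanEntropy P κ (signal u n t) - meanEntropy P κ (signal v n t)
        ≤ l * meanEntropy P κ (signal u n (2 * t)) + a / (2 * l) := by
    have hu1 := mem u hu2 1 zero_le_one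
    have hv1 := mem v hv2 1 zero_le_one
    have hm := mono u v hu hv 1 zero_le_one (by norm_num)
    rw [one_mul] at hu1 hv1 hm
    have h1 := meanEntropy_sub_le (κ := κ) (measurable_signal hu n t) hu1
      (measurable_signal hv n t) hv1 hl ha (hm.trans hw)
    rw [← signal_mul u n zero_le_two] at h1
    have h2 : a / (2 * l) * (2 * l) = a := by field_simp
    rw [← sub_le_iff_le_add', le_div_iff₀ (by positivity)]
    linarith
  have hgf : meanWassersteinSq P κ (signal g n (8 * t)) (signal f n (8 * t))
      ≤ ENNReal.ofReal a := by rwa [meanWassersteinSq_comm]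
  have top := meanEntropy_le (κ := κ) (measurable_signal hh n (8 * t)) hh2
  have f4 := step f h hf hh hf2 hh2 4 (by norm_num) (by norm_num) hb hfh
  have g2 := step g f hg hf hg2 hf2 2 (by norm_num) (by norm_num) ha hgf
  have f2 := step f f hf hf hf2 hf2 2 (by norm_num) (by norm_num) le_rfl (by
    rw [meanWassersteinSq_self]
    exact zero_le)
  have fg := compare f g hf hg hf2 hg2 hfg
  have gf := compare g f hg hf hg2 hf2 hgf
  norm_num at f4 g2 f2
  have F2 : meanEntropy P κ (signal f n (2 * t)) ≤ (K + a + b) / 2 := by linarith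
  have G2 : meanEntropy P κ (signal g n (2 * t)) ≤ (K + a + b) / 2 := by linarith
  have F2' := mul_le_mul_of_nonneg_left F2 hl.le
  have G2' := mul_le_mul_of_nonneg_left G2 hl.le
  rw [abs_le]
  constructor <;> linarith

end Model

theorem eventually_meanWassersteinSq_le {X Θ : Type*} [MeasurableSpace X] [MeasurableSpace Θ]
    {q m : ℕ} {f g : (Fin q → X) × (Fin q → Θ) → EuclideanSpace ℝ (Fin m)} {t : ℝ}
    {P : (n : ℕ) → Measure ((Fin n → X) × (Fin n → Θ))}
    {κ : (n : ℕ) → Kernel (Fin n → X) (Fin n → Θ)} {e e' : ℝ} (he' : 0 < e') (hee' : e < e')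
    (h : limsup (fun n : ℕ => (∫⁻ x, wassersteinSq (condObsLaw f n t (κ n) x)
      (condObsLaw g n t (κ n) x) ∂(P n).fst) / (n : ℝ≥0∞)) atTop ≤ ENNReal.ofReal e) :
    ∀ᶠ n in atTop, meanWassersteinSq (P n) (κ n) (signal f n t) (signal g n t)
      ≤ ENNReal.ofReal (n * e') := by
  have h1 := eventually_lt_of_limsup_lt
    (h.trans_lt ((ENNReal.ofReal_lt_ofReal_iff he').2 hee'))
  filter_upwards [h1, eventually_gt_atTop 0] with n hn hn0
  have h2 := (ENNReal.div_le_iff (by simpa using hn0.ne') (by simp)).1 hn.le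
  rw [mul_comm, ENNReal.ofReal_mul he'.le, ENNReal.ofReal_natCast]
  exact h2

end QWise

theorem mainTheorem2 {X Θ : Type*} [MeasurableSpace X] [MeasurableSpace Θ]
    (q m : ℕ) (hq : 0 < q)
    (f : (Fin q → X) × (Fin q → Θ) → EuclideanSpace ℝ (Fin m)) (hf : Measurable f)
    (P : (n : ℕ) → Measure ((Fin n → X) × (Fin n → Θ)))
    [∀ n, IsProbabilityMeasure (P n)]
    (κ : (n : ℕ) → Kernel (Fin n → X) (Fin n → Θ)) [∀ n, IsMarkovKernel (κ n)]
    [∀ n, (P n).IsCondKernel (κ n)]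
    (hcond : QWise.ApproxCondition f P κ)
    (ε : ℝ) (hε : 0 < ε) (t : ℝ) (ht : 0 ≤ t) :
    ∃ g : (Fin q → X) × (Fin q → Θ) → EuclideanSpace ℝ (Fin m), QWise.IsMultilinear g ∧
      (∀ᶠ n in atTop,
        Integrable (QWise.logPartition f n t (κ n)) (QWise.jointLaw q m n (P n)) ∧
        Integrable (QWise.logPartition g n t (κ n)) (QWise.jointLaw q m n (P n))) ∧
      limsup (fun n : ℕ =>
        ((|QWise.freeEnergy f n t (P n) (κ n) - QWise.freeEnergy g n t (P n) (κ n)| : ℝ)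
          : EReal)) atTop ≤ (ε : EReal) := by
  have ht8 : 0 ≤ 8 * t := by positivity
  obtain ⟨h, hhF, hhW⟩ := hcond 1 one_pos (8 * t) ht8
  obtain ⟨hh, C, hC0, hC⟩ := hhF.measurable_and_bounded
  -- The constants solve `l * (8 t C² + 3) / 2 = ε / 2` and `w / (2 l) ≤ ε / 2` with `w ≤ 1`.
  set K := 8 * t * C ^ 2 + 3 with hK
  have hK0 : 0 < K := by positivity
  set l := ε / K with hl
  have hl0 : 0 < l := by positivity
  set w := min 1 (ε * l) with hw
  have hw0 : 0 < w := lt_min one_pos (by positivity)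
  obtain ⟨g, hgF, hgW⟩ := hcond (w / 2) (by positivity) (8 * t) ht8
  obtain ⟨hg, D, hD0, hD⟩ := hgF.measurable_and_bounded
  have main : ∀ᶠ n in atTop,
      (Integrable (QWise.logPartition f n t (κ n)) (QWise.jointLaw q m n (P n)) ∧
        Integrable (QWise.logPartition g n t (κ n)) (QWise.jointLaw q m n (P n))) ∧
      |QWise.freeEnergy f n t (P n) (κ n) - QWise.freeEnergy g n t (P n) (κ n)| ≤ ε := by
    filter_upwards [eventually_gt_atTop 0,
      QWise.eventually_meanWassersteinSq_le two_pos one_lt_two hhW,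
      QWise.eventually_meanWassersteinSq_le hw0 (half_lt_self hw0) hgW] with n hn hhn hgn
    have hn' : (0 : ℝ) < n := by exact_mod_cast hn
    obtain ⟨hh2, hhK⟩ := QWise.memLp_signal hh hq hC hn ht8 (P n)
    have hg2 := (QWise.memLp_signal hg hq hD hn ht8 (P n)).1
    have hf2 : MemLp (QWise.signal f n (8 * t)) 2 (P n) :=
      QWise.memLp_of_meanWassersteinSq_ne_top (QWise.measurable_signal hf n _)
        (QWise.measurable_signal hh n _) hh2 (hhn.trans_lt ENNReal.ofReal_lt_top).ne
    have down (u : (Fin q → X) × (Fin q → Θ) → EuclideanSpace ℝ (Fin m))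
        (hu : MemLp (QWise.signal u n (8 * t)) 2 (P n)) : MemLp (QWise.signal u n t) 2 (P n) := by
      have h1 := QWise.signal_mul u n (by norm_num : (0 : ℝ) ≤ 1 / 8) (8 * t)
      rw [show 1 / 8 * (8 * t) = t by ring] at h1
      rw [h1]
      exact hu.const_smul √(1 / 8)
    obtain ⟨if1, ef⟩ := QWise.integrable_logPartition (κ := κ n) hf ht (down f hf2)
    obtain ⟨ig1, eg⟩ := QWise.integrable_logPartition (κ := κ n) hg ht (down g hg2)
    refine ⟨⟨if1, ig1⟩, ?_⟩
    have key := QWise.abs_meanEntropy_sub_le (κ := κ n) hf hg hh hf2 hg2 hh2 hl0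
      (by positivity) (by positivity) hhK hgn hhn
    rw [ef, eg, ← mul_sub, abs_mul, abs_of_pos (by positivity : (0 : ℝ) < 1 / n),
      one_div_mul_eq_div, div_le_iff₀ hn']
    refine key.trans ?_
    have hw1 : w ≤ 1 := min_le_left _ _
    have hw2 : w / (2 * l) ≤ ε / 2 := by
      rw [div_le_div_iff₀ (by positivity) two_pos]
      have := min_le_right 1 (ε * l)
      linarith
    have hlK : l * K = ε := by rw [hl]; field_simp
    have h3 : l * ((8 * t * C ^ 2 + w + 2) / 2) ≤ ε / 2 := by
      rw [← hlK, mul_div_assoc]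
      gcongr
      linarith
    calc l * ((n * (8 * t * C ^ 2) + n * w + n * 2) / 2) + n * w / (2 * l)
        = n * (l * ((8 * t * C ^ 2 + w + 2) / 2) + w / (2 * l)) := by ring
      _ ≤ n * (ε / 2 + ε / 2) := by gcongr
      _ = ε * n := by ring
  refine ⟨g, hgF, main.mono fun n hn => hn.1, limsup_le_of_le ?_ ?_⟩
  · isBoundedDefault
  · exact main.mono fun n hn => by exact_mod_cast hn.2
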